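/- Let $V:\mathbb R^3\to\mathbb R$ be measurable with $|V(x)|\le C\langle x\rangle^{-\beta}$ for some constants $C$ and $\beta>5$, where $\langle x\rangle=(1+|x|^2)^{1/2}$, and let $H=-\Delta+V$ in the complex space $L^2=L^2(\mathbb R^3)$ with domain $H^2(\mathbb R^3)$. Put $v=|V|^{1/2}$, $U=1$ where $V\ge0$ and $U=-1$ where $V<0$, and for $j=0,1,2$ let $G_j$ be the integral operator with kernel $\frac{1}{4\pi\, j!}|x-y|^{j-1}$. Then $vG_0v$, $vG_1v$ and $vG_2v$ are bounded operators on $L^2$, given by absolutely convergent integrals. Let $S_1$ be the orthogonal projection of $L^2$ onto the kernel of $A_0=U+vG_0v$, and let $S_2$ be the orthogonal projection onto the kernel of $m(0)=S_1\,(i\,vG_1v)\,S_1$, the latter regarded as an operator on $S_1L^2$. Then: 1. $S_2vG_2vS_2$ is invertible as an operator on $S_2L^2$. 2. $G_0vS_2$ is a bounded operator on $L^2$. The operator $S_2vG_0$, defined by absolutely convergent integrals (with $vG_0f\in L^2$) for all $f$ with $\langle x\rangle^{\sigma}f\in L^2$ for some $\sigma>\frac12$, extends from this dense subspace to a bounded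 operator on $L^2$. 3. With these operators, $$-\,G_0\,v\,S_2\,[S_2\,v\,G_2\,v\,S_2]^{-1}\,S_2\,v\,G_0$$ is the orthogonal projection in $L^2$ onto the eigenspace $\{g\in H^2(\mathbb R^3): Hg=0\}$ of $H$ at zero energy. -/

import Mathlib

open MeasureTheory
open scoped SchwartzMap ENNReal Laplacian Nat

noncomputable section

namespace ZeroEnergy

/-- Three-dimensional Euclidean space. -/
abbrev R3 : Type := EuclideanSpace ℝ (Fin 3)

/-- The complex Hilbert space `L²(ℝ³)`. -/
abbrev L2 : Type := Lp ℂ 2 (volume : Measure R3)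

/-- The Japanese bracket `⟨x⟩ = (1 + |x|²)^{1/2}`. -/
def bracket (x : R3) : ℝ := Real.sqrt (1 + ‖x‖ ^ 2)

/-! ### The Hamiltonian -/

/-- Multiplication by an essentially bounded real function, as an operator on `L²(ℝ³)`
(and `0` if the function is not essentially bounded and measurable). -/
def mulOp (a : R3 → ℝ) : L2 →L[ℂ] L2 :=
  open Classical in
  if h : MemLp (fun x => (a x : ℂ)) ∞ (volume : Measure R3) then
    (ContinuousLinearMap.lsmul ℂ ℂ).holderL volume ∞ 2 2 (h.toLp _)
  else 0

/-- The canonical embedding `L²(ℝ³) → 𝓢'(ℝ³)`. -/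
def toDist : L2 →L[ℂ] 𝓢'(R3, ℂ) := Lp.toTemperedDistributionCLM ℂ volume 2

theorem toDist_injective : Function.Injective toDist :=
  LinearMap.ker_eq_bot.mp Lp.ker_toTemperedDistributionCLM_eq_bot

/-- The Sobolev space `H²(ℝ³)` as a subspace of `L²(ℝ³)`. -/
def sobolevH2 : Submodule ℂ L2 where
  carrier := {g | TemperedDistribution.MemSobolev 2 2 (toDist g)}
  add_mem' {f g} hf hg := by
    simpa only [Set.mem_ofPred_eq, map_add] using hf.add hg
  zero_mem' := by
    simpa only [Set.mem_ofPred_eq, map_zero] using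
      TemperedDistribution.memSobolev_fun_zero (E := R3) (F := ℂ) 2 2
  smul_mem' c f hf := by
    simpa only [Set.mem_ofPred_eq, map_smul] using hf.smul c

theorem exists_laplacian (g : sobolevH2) :
    ∃ h : L2, toDist h = Δ (toDist (g : L2)) := by
  have h0 : TemperedDistribution.MemSobolev 0 2 (Δ (toDist (g : L2))) := by
    have := TemperedDistribution.MemSobolev.laplacian g.2
    simpa using this
  obtain ⟨h, hh⟩ := TemperedDistribution.memSobolev_zero_iff.mp h0
  exact ⟨h, hh.symm⟩

/-- The distributional Laplacian as a linear map `H²(ℝ³) → L²(ℝ³)`. -/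
def laplacianH2 : sobolevH2 →ₗ[ℂ] L2 where
  toFun g := (exists_laplacian g).choose
  map_add' f g := by
    apply toDist_injective
    rw [map_add, (exists_laplacian _).choose_spec, (exists_laplacian f).choose_spec,
      (exists_laplacian g).choose_spec, Submodule.coe_add, map_add]
    simp only [← TemperedDistribution.laplacianCLM_apply, map_add]
  map_smul' c f := by
    apply toDist_injective
    rw [RingHom.id_apply, map_smul, (exists_laplacian _).choose_spec,
      (exists_laplacian f).choose_spec, Submodule.coe_smul, map_smul]
    simp only [← TemperedDistribution.laplacianCLM_apply, map_smul]

/-- The Schrödinger operator `H = -Δ + V` in `L²(ℝ³)` with domain `H²(ℝ³)`, for bounded `V`. -/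
def hamiltonian (V : R3 → ℝ) : L2 →ₗ.[ℂ] L2 where
  domain := sobolevH2
  toFun := -laplacianH2 + (mulOp V : L2 →ₗ[ℂ] L2) ∘ₗ sobolevH2.subtype

/-- The eigenspace at energy `E` of an operator `T` in `L²(ℝ³)`:
all `g` in the domain of `T` with `T g = E g`. -/
def eigenspaceAt (T : L2 →ₗ.[ℂ] L2) (E : ℂ) : Submodule ℂ L2 :=
  (LinearMap.ker (T.toFun - E • T.domain.subtype)).map T.domain.subtype

/-! ### Integral operators -/

/-- The kernel `G_j(x, y) = |x - y|^{j-1} / (4 π j!)`. -/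
def kerG (j : ℕ) (x y : R3) : ℝ := ‖x - y‖ ^ ((j : ℤ) - 1) / (4 * Real.pi * (j !))

/-- `(G_0 h)(x) = ∫ h(y) / (4 π |x - y|) dy`. -/
def applyG0 (h : R3 → ℂ) (x : R3) : ℂ := ∫ y, (kerG 0 x y : ℂ) * h y

/-- The bounded operator `T` on `L²(ℝ³)` is given by an absolutely convergent integral with
kernel `K`. There is at most one such `T`. -/
def HasKernel (K : R3 → R3 → ℝ) (T : L2 →L[ℂ] L2) : Prop :=
  ∀ f : L2, ∀ᵐ x : R3, Integrable (fun y => (K x y : ℂ) * f y) ∧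
    T f x = ∫ y, (K x y : ℂ) * f y

/-- The bounded operator on `L²(ℝ³)` with kernel `K` (and `0` if there is none). -/
def integralOp (K : R3 → R3 → ℝ) : L2 →L[ℂ] L2 :=
  open Classical in if h : ∃ T, HasKernel K T then h.choose else 0

/-! ### The operators of the threshold expansion -/

/-- `v = |V|^{1/2}`. -/
def vFun (V : R3 → ℝ) (x : R3) : ℝ := Real.sqrt |V x|

/-- `U = 1` where `V ≥ 0` and `U = -1` where `V < 0`. -/
def uFun (V : R3 → ℝ) (x : R3) : ℝ := if 0 ≤ V x then 1 else -1

/-- The kernel `v(x) G_j(x, y) v(y)`. -/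
def kerVGV (V : R3 → ℝ) (j : ℕ) (x y : R3) : ℝ := vFun V x * kerG j x y * vFun V y

/-- The operator `v G_j v` on `L²(ℝ³)`. -/
def opVGV (V : R3 → ℝ) (j : ℕ) : L2 →L[ℂ] L2 := integralOp (kerVGV V j)

/-- `A_0 = U + v G_0 v`. -/
def opA0 (V : R3 → ℝ) : L2 →L[ℂ] L2 := mulOp (uFun V) + opVGV V 0

/-- `A_1(0) = i v G_1 v`. -/
def opA1 (V : R3 → ℝ) : L2 →L[ℂ] L2 := Complex.I • opVGV V 1

/-- `S_1 L² = ker A_0`. -/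
def ranS1 (V : R3 → ℝ) : Submodule ℂ L2 := LinearMap.ker (opA0 V : L2 →ₗ[ℂ] L2)

instance (V : R3 → ℝ) : CompleteSpace (ranS1 V) :=
  ContinuousLinearMap.completeSpace_ker (opA0 V)

/-- `m(0) = S_1 A_1(0) S_1`, as an operator on `S_1 L²`. -/
def opM0 (V : R3 → ℝ) : ranS1 V →L[ℂ] ranS1 V :=
  (ranS1 V).orthogonalProjectionOnto ∘L opA1 V ∘L (ranS1 V).subtypeL

/-- `S_2 L²`, the kernel of `m(0)` on `S_1 L²`, as a subspace of `L²(ℝ³)`. -/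
def ranS2 (V : R3 → ℝ) : Submodule ℂ L2 :=
  (LinearMap.ker (opM0 V : ranS1 V →ₗ[ℂ] ranS1 V)).map (ranS1 V).subtype

instance (V : R3 → ℝ) : CompleteSpace (ranS2 V) := by
  have h : IsComplete
      (LinearMap.ker (opM0 V : ranS1 V →ₗ[ℂ] ranS1 V) : Set (ranS1 V)) :=
    completeSpace_coe_iff_isComplete.mp (ContinuousLinearMap.completeSpace_ker (opM0 V))
  exact completeSpace_coe_iff_isComplete.mpr
    ((isComplete_image_iff (ranS1 V).subtypeₗᵢ.isometry.isUniformInducing).mpr h)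

/-- `S_2`, the orthogonal projection of `L²(ℝ³)` onto `S_2 L²`, with values in `S_2 L²`. -/
def projS2 (V : R3 → ℝ) : L2 →L[ℂ] ranS2 V := (ranS2 V).orthogonalProjectionOnto

/-- `S_2 v G_2 v S_2`, as an operator on `S_2 L²`. -/
def opS2VG2VS2 (V : R3 → ℝ) : ranS2 V →L[ℂ] ranS2 V :=
  projS2 V ∘L opVGV V 2 ∘L (ranS2 V).subtypeL

/-- `T : S_2 L² → L²(ℝ³)` is the operator `G_0 v S_2`. -/
def IsG0VS2 (V : R3 → ℝ) (T : ranS2 V →L[ℂ] L2) : Prop :=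
  ∀ ψ : ranS2 V,
    (∀ᵐ x : R3, Integrable (fun y => (kerG 0 x y : ℂ) * ((vFun V y : ℂ) * (ψ : L2) y))) ∧
    (T ψ : R3 → ℂ) =ᵐ[volume] applyG0 (fun y => (vFun V y : ℂ) * (ψ : L2) y)

/-- `R : L²(ℝ³) → S_2 L²` is the operator `S_2 v G_0`. For general `f ∈ L²(ℝ³)` the integral
`G_0 f` need not converge, so `S_2 v G_0` is the bounded operator given by `f ↦ S_2 (v G_0 f)`
on the dense subspace of all `f` with `⟨x⟩^σ f ∈ L²(ℝ³)` for some `σ > 1/2`; there is at most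
one such operator. -/
def IsS2VG0 (V : R3 → ℝ) (R : L2 →L[ℂ] ranS2 V) : Prop :=
  ∀ (σ : ℝ) (f : L2), 1 / 2 < σ →
    MemLp (fun x => ((bracket x ^ σ : ℝ) : ℂ) * f x) 2 (volume : Measure R3) →
    (∀ᵐ x : R3, Integrable (fun y => (kerG 0 x y : ℂ) * f y)) ∧
    ∃ h : L2, (h : R3 → ℂ) =ᵐ[volume] (fun x => (vFun V x : ℂ) * applyG0 f x) ∧
      R f = projS2 V h

end ZeroEnergy

end

/-! Write `T` for `G₀vS₂`. Everything rests on the identity `S₂vG₂vS₂ = -T*T`.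

The kernel of `G₁` is constant, so `vG₁v` has rank at most one, and `S₂L²` consists of the `ψ` in
the kernel of `A₀` for which the density `ρ = vψ` has total charge `∫ vψ = 0` (`mem_ranS2_iff`). For
a neutral density with finite first moment, `𝓕ρ` is `O(|ξ|)` at the origin. Hence `𝓕ρ/(4π²|ξ|²)` is
square integrable in dimension three and `G₀ρ` lies in `L²`. By Parseval, the inner product of two
such potentials is an integral against `|ξ|⁻⁴`, which in position space is the kernel `-|x-y|/(8π)`
up to an infinite constant. Neutrality removes that constant, which gives `⟨G₀ρ₁, G₀ρ₂⟩ = -⟨ρ₁,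
G₂ρ₂⟩` (`integral_star_greenHat_mul`). Both Fourier identities are proved without distributional
limits, by writing the kernels as superpositions of Gaussians over a heat parameter `t` and
comparing the two sides for each `t`.

On the kernel of `A₀` one has `ψ = -U v Tψ` with `v` bounded, so `T` is bounded below. Therefore
`-T*T` is invertible, `S₂vG₀` is realized as `T*`, and the operator of the theorem is `T(T*T)⁻¹T*`,
the orthogonal projection onto the range of `T`. That range is the eigenspace (`range_potentialL`):
`g = Tψ` satisfies `-Δg = vψ = -Vg`. Conversely, for a zero-energy eigenfunction `g`, the choice `ψ
= -Uvg` gives `𝓕(vψ)/(4π²|ξ|²) = 𝓕g`, whose square integrability forces the charge to vanish. -/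

namespace ZeroEnergy

/-! ### Weights and singular integrals on `ℝ³`. -/

theorem one_le_bracket (x : R3) : 1 ≤ bracket x := by
  unfold bracket
  rw [Real.one_le_sqrt]
  nlinarith [sq_nonneg ‖x‖]

theorem bracket_pos (x : R3) : 0 < bracket x := one_pos.trans_le (one_le_bracket x)

theorem bracket_sq (x : R3) : bracket x ^ 2 = 1 + ‖x‖ ^ 2 := by
  unfold bracket
  rw [Real.sq_sqrt (by positivity)]

theorem norm_le_bracket (x : R3) : ‖x‖ ≤ bracket x := by
  apply le_of_sq_le_sq _ (bracket_pos x).le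
  rw [bracket_sq]; linarith

theorem continuous_bracket : Continuous bracket := by
  unfold bracket; fun_prop

theorem continuous_bracket_rpow (s : ℝ) : Continuous fun x => bracket x ^ s :=
  continuous_bracket.rpow_const fun x => Or.inl (bracket_pos x).ne'

theorem bracket_rpow_pos (x : R3) (s : ℝ) : 0 < bracket x ^ s :=
  Real.rpow_pos_of_pos (bracket_pos x) s

theorem finrank_R3 : Module.finrank ℝ R3 = 3 := by simp

theorem integrable_bracket_rpow {s : ℝ} (hs : 3 < s) :
    Integrable (fun x : R3 => bracket x ^ (-s)) := by
  have := integrable_rpow_neg_one_add_norm_sq (E := R3) (μ := volume) (r := s)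
    (by rw [finrank_R3]; exact_mod_cast hs)
  refine this.congr (ae_of_all _ fun x => ?_)
  simp only [bracket]
  rw [Real.sqrt_eq_rpow, ← Real.rpow_mul (by positivity)]
  congr 1; ring

theorem integrableOn_ball_norm_zpow_neg_two :
    IntegrableOn (fun x : R3 => (‖x‖ ^ 2)⁻¹) (Metric.ball 0 1) := by
  rw [integrableOn_fun_norm_addHaar (μ := (volume : Measure R3)) (f := fun r => (r ^ 2)⁻¹),
    finrank_R3]
  refine (integrableOn_const (C := (1 : ℝ)) (by simp) (by simp)).congr_fun (fun y hy => ?_)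
    measurableSet_Ioo
  have : y ≠ 0 := hy.1.ne'
  simp [this]

/-- Polar coordinates leave `r⁻²`, which diverges at the origin. This divergence later rules out a
nonzero total charge. -/
theorem not_integrableOn_ball_norm_zpow_neg_four {r : ℝ} (hr : 0 < r) :
    ¬ IntegrableOn (fun x : R3 => (‖x‖ ^ 4)⁻¹) (Metric.ball 0 r) := by
  rw [integrableOn_fun_norm_addHaar (μ := (volume : Measure R3)) (f := fun r => (r ^ 4)⁻¹),
    finrank_R3]
  intro h
  have h2 : IntegrableOn (fun y : ℝ => y ^ (-2 : ℝ)) (Set.Ioo 0 r) := by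
    refine h.congr_fun (fun y hy => ?_) measurableSet_Ioo
    have : y ≠ 0 := hy.1.ne'
    have h3 : y ^ (-2 : ℝ) = (y ^ 2)⁻¹ := by
      rw [Real.rpow_neg hy.1.le]; norm_cast
    simp only [h3, smul_eq_mul]
    field_simp
  rw [intervalIntegral.integrableOn_Ioo_rpow_iff hr] at h2
  norm_num at h2

/-- Pointwise control of `|x - y|⁻² ⟨y⟩^{-s}` by functions of `x - y` and of `y` alone. -/
theorem inv_norm_sq_mul_bracket_le {s : ℝ} (hs : 0 < s) (x y : R3) :
    (‖x - y‖ ^ 2)⁻¹ * bracket y ^ (-s) ≤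
      (Metric.ball (0 : R3) 1).indicator (fun z => (‖z‖ ^ 2)⁻¹) (x - y) +
        (2 * bracket (x - y) ^ (-(2 + s)) + 2 * bracket y ^ (-(2 + s))) := by
  have hy := bracket_pos y
  have hz := bracket_pos (x - y)
  have p1 := bracket_rpow_pos y (-(2 + s))
  have p2 := bracket_rpow_pos (x - y) (-(2 + s))
  by_cases h : x - y ∈ Metric.ball (0 : R3) 1
  · rw [Set.indicator_of_mem h]
    have h1 : bracket y ^ (-s) ≤ 1 :=
      Real.rpow_le_one_of_one_le_of_nonpos (one_le_bracket y) (by linarith)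
    have h2 : (‖x - y‖ ^ 2)⁻¹ * bracket y ^ (-s) ≤ (‖x - y‖ ^ 2)⁻¹ * 1 := by gcongr
    linarith
  · rw [Set.indicator_of_notMem h]
    have h1 : 1 ≤ ‖x - y‖ := by simpa using h
    have h2 : (‖x - y‖ ^ 2)⁻¹ ≤ 2 * bracket (x - y) ^ (-2 : ℝ) := by
      rw [Real.rpow_neg hz.le, show bracket (x - y) ^ (2 : ℝ) = bracket (x - y) ^ 2 by norm_cast,
        bracket_sq, inv_le_comm₀ (by positivity) (by positivity), mul_inv, inv_inv]
      nlinarith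
    have h3 : (‖x - y‖ ^ 2)⁻¹ * bracket y ^ (-s) ≤
        2 * bracket (x - y) ^ (-2 : ℝ) * bracket y ^ (-s) := by
      have := bracket_rpow_pos y (-s)
      gcongr
    have key : bracket (x - y) ^ (-2 : ℝ) * bracket y ^ (-s) ≤
        bracket (x - y) ^ (-(2 + s)) + bracket y ^ (-(2 + s)) := by
      -- The product is at most the power `-(2 + s)` of whichever bracket is smaller.
      rcases le_total (bracket (x - y)) (bracket y) with hle | hle
      · have : bracket y ^ (-s) ≤ bracket (x - y) ^ (-s) :=
          Real.rpow_le_rpow_of_nonpos hz hle (by linarith)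
        calc _ ≤ bracket (x - y) ^ (-2 : ℝ) * bracket (x - y) ^ (-s) := by gcongr
          _ = bracket (x - y) ^ (-(2 + s)) := by rw [← Real.rpow_add hz]; congr 1; ring
          _ ≤ _ := by linarith
      · have : bracket (x - y) ^ (-2 : ℝ) ≤ bracket y ^ (-2 : ℝ) :=
          Real.rpow_le_rpow_of_nonpos hy hle (by norm_num)
        have q := bracket_rpow_pos y (-s)
        calc _ ≤ bracket y ^ (-2 : ℝ) * bracket y ^ (-s) := by gcongr
          _ = bracket y ^ (-(2 + s)) := by rw [← Real.rpow_add hy]; congr 1; ring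
          _ ≤ _ := by linarith
    linarith

/-- Uniformity in `x` comes from translation invariance, since the majorant splits into functions of
`x - y` and of `y` alone. The tail exponent `2 + s` exceeds the dimension when `s > 1`. -/
theorem exists_integral_inv_norm_sq_mul_bracket_le {s : ℝ} (hs : 1 < s) :
    ∃ M : ℝ, 0 ≤ M ∧ ∀ x : R3,
      Integrable (fun y : R3 => (‖x - y‖ ^ 2)⁻¹ * bracket y ^ (-s)) ∧
      ∫ y : R3, (‖x - y‖ ^ 2)⁻¹ * bracket y ^ (-s) ≤ M := by
  have i1 : Integrable ((Metric.ball (0 : R3) 1).indicator (fun z => (‖z‖ ^ 2)⁻¹)) :=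
    (integrable_indicator_iff measurableSet_ball).mpr integrableOn_ball_norm_zpow_neg_two
  have i2 : Integrable (fun y : R3 => 2 * bracket y ^ (-(2 + s))) :=
    (integrable_bracket_rpow (by linarith)).const_mul 2
  set a : R3 → ℝ := (Metric.ball (0 : R3) 1).indicator (fun z => (‖z‖ ^ 2)⁻¹)
  set b : R3 → ℝ := fun y : R3 => 2 * bracket y ^ (-(2 + s))
  have ipos : ∀ x y : R3, 0 ≤ (‖x - y‖ ^ 2)⁻¹ * bracket y ^ (-s) := fun x y => by
    have := bracket_rpow_pos y (-s)
    positivity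
  have hint : ∀ x : R3, Integrable fun y : R3 => a (x - y) + (b (x - y) + b y) := fun x =>
    (i1.comp_sub_left x).add ((i2.comp_sub_left x).add i2)
  have hi : ∀ x : R3, Integrable (fun y : R3 => (‖x - y‖ ^ 2)⁻¹ * bracket y ^ (-s)) := fun x => by
    refine (hint x).mono' ?_ (ae_of_all _ fun y => ?_)
    · have := (continuous_bracket_rpow (-s)).measurable
      exact Measurable.aestronglyMeasurable (by fun_prop)
    · rw [Real.norm_of_nonneg (ipos x y)]
      exact inv_norm_sq_mul_bracket_le (by linarith) x y
  refine ⟨(∫ y, a y) + ((∫ y, b y) + ∫ y, b y), ?_, fun x => ⟨hi x, ?_⟩⟩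
  · have h1 : 0 ≤ ∫ y, a y :=
      integral_nonneg fun y => Set.indicator_nonneg (fun _ _ => by positivity) y
    have h2 : 0 ≤ ∫ y, b y := integral_nonneg fun y => by
      have := bracket_rpow_pos y (-(2 + s))
      simp only [b, Pi.zero_apply]; positivity
    linarith
  · calc _ ≤ ∫ y, (a (x - y) + (b (x - y) + b y)) :=
        integral_mono (hi x) (hint x) fun y => inv_norm_sq_mul_bracket_le (by linarith) x y
      _ = _ := by
        rw [integral_add (i1.comp_sub_left x)
            (by exact (i2.comp_sub_left x).add i2 : Integrable fun y => b (x - y) + b y),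
          integral_add (i2.comp_sub_left x) i2, integral_sub_left_eq_self a,
          integral_sub_left_eq_self b]

end ZeroEnergy

/-! ### Powers of the distance and of the frequency as integrals over the heat parameter. -/

namespace ZeroEnergy

open Real Set Filter Topology

/-- The substitution `t ↦ t⁻¹` turns this into the Gamma integral at `1/2`. -/
theorem integral_gaussian_scale {r : ℝ} (hr : 0 < r) :
    ∫ t in Ioi (0 : ℝ), t ^ (-3 / 2 : ℝ) * exp (-(π * r ^ 2 / t)) = r⁻¹ := by
  have h1 := integral_comp_rpow_Ioi
    (fun b : ℝ => b ^ ((1 / 2 : ℝ) - 1) * exp (-((π * r ^ 2) * b))) (p := -1) (by norm_num)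
  rw [integral_rpow_mul_exp_neg_mul_Ioi (by norm_num) (by positivity), Gamma_one_half_eq] at h1
  have h2 : (1 / (π * r ^ 2)) ^ (1 / 2 : ℝ) * √π = r⁻¹ := by
    rw [← sqrt_eq_rpow, ← sqrt_mul (by positivity)]
    rw [show 1 / (π * r ^ 2) * π = (r⁻¹) ^ 2 by field_simp, sqrt_sq (by positivity)]
  rw [← h2, ← h1]
  refine setIntegral_congr_fun measurableSet_Ioi fun t ht => ?_
  have ht : 0 < t := ht
  simp only [smul_eq_mul]
  rw [rpow_neg_one t, ← rpow_neg_one t, ← rpow_mul ht.le, ← mul_assoc, abs_neg, abs_one, one_mul,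
    ← rpow_add ht, rpow_neg_one]
  norm_num [div_eq_mul_inv]

theorem integrableOn_gaussian_scale {r : ℝ} (hr : 0 < r) :
    IntegrableOn (fun t : ℝ => t ^ (-3 / 2 : ℝ) * exp (-(π * r ^ 2 / t))) (Ioi 0) :=
  -- The Bochner integral of a non-integrable function is zero by convention, so a nonzero value
  -- already proves integrability.
  Integrable.of_integral_ne_zero (by rw [integral_gaussian_scale hr]; positivity)

theorem integral_exp_neg_scale {r : ℝ} (hr : 0 < r) :
    ∫ t in Ioi (0 : ℝ), exp (-(π * r ^ 2 * t)) = (π * r ^ 2)⁻¹ := by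
  have := integral_rpow_mul_exp_neg_mul_Ioi (a := 1) (r := π * r ^ 2) (by norm_num) (by positivity)
  simpa using this

theorem integrableOn_exp_neg_scale {r : ℝ} (hr : 0 < r) :
    IntegrableOn (fun t : ℝ => exp (-(π * r ^ 2 * t))) (Ioi 0) :=
  Integrable.of_integral_ne_zero (by rw [integral_exp_neg_scale hr]; positivity)

theorem integral_mul_exp_neg_scale {r : ℝ} (hr : 0 < r) :
    ∫ t in Ioi (0 : ℝ), t * exp (-(π * r ^ 2 * t)) = ((π * r ^ 2) ^ 2)⁻¹ := by
  have := integral_rpow_mul_exp_neg_mul_Ioi (a := 2) (r := π * r ^ 2) (by norm_num) (by positivity)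
  norm_num at this
  rw [this]
  field_simp

theorem integrableOn_mul_exp_neg_scale {r : ℝ} (hr : 0 < r) :
    IntegrableOn (fun t : ℝ => t * exp (-(π * r ^ 2 * t))) (Ioi 0) :=
  Integrable.of_integral_ne_zero (by rw [integral_mul_exp_neg_scale hr]; positivity)

theorem one_sub_exp_neg_div_nonneg {c t : ℝ} (hc : 0 ≤ c) (ht : 0 < t) : 0 ≤ 1 - exp (-(c / t)) := by
  have : exp (-(c / t)) ≤ 1 := exp_le_one_iff.mpr (by simp; positivity)
  linarith

theorem one_sub_exp_neg_div_le {c t : ℝ} : 1 - exp (-(c / t)) ≤ c / t := by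
  have := add_one_le_exp (-(c / t))
  linarith

theorem integrableOn_rpow_mul_one_sub_exp {c : ℝ} (hc : 0 ≤ c) :
    IntegrableOn (fun t : ℝ => t ^ (-1 / 2 : ℝ) * (1 - exp (-(c / t)))) (Ioi 0) := by
  have hm : Measurable (fun t : ℝ => t ^ (-1 / 2 : ℝ) * (1 - exp (-(c / t)))) := by fun_prop
  rw [← Ioc_union_Ioi_eq_Ioi (zero_le_one' ℝ)]
  refine IntegrableOn.union ?_ ?_
  · have h1 : IntegrableOn (fun t : ℝ => t ^ (-1 / 2 : ℝ)) (Ioc 0 1) :=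
      (intervalIntegrable_iff_integrableOn_Ioc_of_le zero_le_one).mp
        (intervalIntegral.intervalIntegrable_rpow' (by norm_num))
    refine h1.mono' hm.aestronglyMeasurable ((ae_restrict_mem measurableSet_Ioc).mono fun t ht => ?_)
    have ht0 : 0 < t := ht.1
    have h2 := one_sub_exp_neg_div_nonneg hc ht0
    rw [norm_of_nonneg (by positivity)]
    have h3 := exp_pos (-(c / t))
    exact mul_le_of_le_one_right (by positivity) (by linarith)
  · have h1 : IntegrableOn (fun t : ℝ => c * t ^ (-3 / 2 : ℝ)) (Ioi 1) :=
      (integrableOn_Ioi_rpow_of_lt (by norm_num) one_pos).const_mul c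
    refine h1.mono' hm.aestronglyMeasurable ((ae_restrict_mem measurableSet_Ioi).mono fun t ht => ?_)
    have ht0 : 0 < t := one_pos.trans ht
    have h2 := one_sub_exp_neg_div_nonneg hc ht0
    rw [norm_of_nonneg (by positivity)]
    calc t ^ (-1 / 2 : ℝ) * (1 - exp (-(c / t))) ≤ t ^ (-1 / 2 : ℝ) * (c / t) := by
          gcongr; exact one_sub_exp_neg_div_le
      _ = c * t ^ (-3 / 2 : ℝ) := by
        rw [show (-3 / 2 : ℝ) = -1 / 2 - 1 by norm_num, rpow_sub_one ht0.ne']; ring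

/-- Integration by parts: `2√t (1 - exp(-c/t))` vanishes at both ends, and its derivative is this
integrand minus `2c` times that of `integral_gaussian_scale`. With `c = πr²` the value is `2c/r =
2πr`. The subtracted exponential provides convergence at infinity, where `t^(-1/2)` alone fails. -/
theorem integral_rpow_mul_one_sub_exp {r : ℝ} (hr : 0 ≤ r) :
    ∫ t in Ioi (0 : ℝ), t ^ (-1 / 2 : ℝ) * (1 - exp (-(π * r ^ 2 / t))) = 2 * π * r := by
  rcases hr.eq_or_lt with rfl | hr
  · simp
  set c := π * r ^ 2 with hc
  have hc0 : 0 < c := by positivity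
  have i1 := integrableOn_rpow_mul_one_sub_exp hc0.le
  have i2 := (integrableOn_gaussian_scale hr).const_mul (2 * c)
  have hF := integral_Ioi_of_hasDerivAt_of_tendsto (a := 0) (m := 0)
    (f := fun t : ℝ => 2 * √t * (1 - exp (-(c / t))))
    (f' := fun t : ℝ => t ^ (-1 / 2 : ℝ) * (1 - exp (-(c / t))) -
      2 * c * (t ^ (-3 / 2 : ℝ) * exp (-(c / t)))) ?_ ?_ (i1.sub i2) ?_
  · rw [integral_sub i1 i2, integral_const_mul, integral_gaussian_scale hr] at hF
    simp only [sqrt_zero, mul_zero, zero_mul, sub_zero, sub_eq_zero] at hF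
    rw [hF, hc]; field_simp
  · rw [ContinuousWithinAt]
    simp only [sqrt_zero, mul_zero, zero_mul]
    have h0 : Tendsto (fun t : ℝ => 2 * √t) (𝓝[Ici 0] 0) (𝓝 0) := by
      have : Continuous fun t : ℝ => 2 * √t := by fun_prop
      simpa using (this.tendsto 0).mono_left nhdsWithin_le_nhds
    refine squeeze_zero' ?_ ?_ h0
    · filter_upwards [self_mem_nhdsWithin] with t ht
      rcases (show (0 : ℝ) ≤ t from ht).eq_or_lt with rfl | ht
      · simp
      · have := one_sub_exp_neg_div_nonneg hc0.le ht
        positivity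
    · filter_upwards [self_mem_nhdsWithin] with t ht
      have := exp_pos (-(c / t))
      exact mul_le_of_le_one_right (by positivity) (by linarith)
  · intro t ht
    have ht : 0 < t := ht
    have h1 := (hasDerivAt_sqrt ht.ne').const_mul 2
    have h2 : HasDerivAt (fun t : ℝ => 1 - exp (-(c / t))) (-(exp (-(c / t)) * (c / t ^ 2))) t := by
      have h3 : HasDerivAt (fun t : ℝ => -(c / t)) (c / t ^ 2) t := by
        have := ((hasDerivAt_inv ht.ne').const_mul c).neg
        refine (this.congr_deriv ?_).congr_of_eventuallyEq (Eventually.of_forall fun s => ?_)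
        · field_simp
        · simp [div_eq_mul_inv]
      exact h3.exp.const_sub 1
    refine (h1.mul h2).congr_deriv ?_
    have e1 : t ^ (-1 / 2 : ℝ) = 1 / √t := by
      rw [show (-1 / 2 : ℝ) = -(1 / 2) by norm_num, rpow_neg ht.le, ← sqrt_eq_rpow, one_div]
    have e2 : t ^ (-3 / 2 : ℝ) = √t / t ^ 2 := by
      rw [sqrt_eq_rpow, ← rpow_natCast t 2, ← rpow_sub ht]; norm_num
    rw [e1, e2]
    ring
  · have h0 : Tendsto (fun t : ℝ => 2 * c * t ^ (-(1 / 2 : ℝ))) atTop (𝓝 0) := by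
      simpa using (tendsto_rpow_neg_atTop (y := 1 / 2) (by norm_num)).const_mul (2 * c)
    refine squeeze_zero' ?_ ?_ h0
    · filter_upwards [eventually_gt_atTop 0] with t ht
      have := one_sub_exp_neg_div_nonneg hc0.le ht
      positivity
    · filter_upwards [eventually_gt_atTop 0] with t ht
      calc 2 * √t * (1 - exp (-(c / t))) ≤ 2 * √t * (c / t) := by
            gcongr; exact one_sub_exp_neg_div_le
        _ = 2 * c * t ^ (-(1 / 2 : ℝ)) := by
          rw [show (-(1 / 2) : ℝ) = 1 / 2 - 1 by norm_num, rpow_sub_one ht.ne', ← sqrt_eq_rpow]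
          ring

end ZeroEnergy

/-! ### Fourier transforms on `L¹`, `L²` and tempered distributions; regularity in `H²`. -/

namespace ZeroEnergy

open FourierTransform

theorem ae_eq_of_forall_schwartz {F h : R3 → ℂ} (hF : LocallyIntegrable F)
    (hh : LocallyIntegrable h) (H : ∀ u : 𝓢(R3, ℂ), ∫ x, u x * F x = ∫ x, u x * h x) :
    F =ᵐ[volume] h := by
  refine ae_eq_of_integral_contDiff_smul_eq hF hh fun g g_smooth g_cpt => ?_
  have hg₁ : HasCompactSupport (Complex.ofRealCLM ∘ g) := g_cpt.comp_left rfl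
  have hg₂ : ContDiff ℝ ((⊤ : ℕ∞) : WithTop ℕ∞) (Complex.ofRealCLM ∘ g) := by fun_prop
  simpa using H (hg₁.toSchwartzMap hg₂)

theorem toDist_apply (f : L2) (u : 𝓢(R3, ℂ)) : toDist f u = ∫ x, u x * f x := by
  simp [toDist]

theorem fourier_toDist (f : L2) : 𝓕 (toDist f) = toDist (𝓕 f) :=
  Lp.fourier_toTemperedDistribution_eq f

theorem fourierInv_toDist (f : L2) : 𝓕⁻ (toDist f) = toDist (𝓕⁻ f) :=
  Lp.fourierInv_toTemperedDistribution_eq f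

theorem locallyIntegrable_L2 (f : L2) : LocallyIntegrable f :=
  (Lp.memLp f).locallyIntegrable one_le_two

theorem integral_fourier_mul_comm {f g : R3 → ℂ} (hf : Integrable f) (hg : Integrable g) :
    ∫ ξ, 𝓕 f ξ * g ξ = ∫ x, f x * 𝓕 g x := by
  simpa using! VectorFourier.integral_fourierIntegral_smul_eq_flip (L := innerₗ R3)
    (μ := volume) (ν := volume) Real.continuous_fourierChar continuous_inner hf hg

theorem integral_fourierInv_mul_comm {f g : R3 → ℂ} (hf : Integrable f) (hg : Integrable g) :
    ∫ ξ, 𝓕⁻ f ξ * g ξ = ∫ x, f x * 𝓕⁻ g x := by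
  simp only [Real.fourierInv_eq_fourier_comp_neg]
  rw [integral_fourier_mul_comm hf.comp_neg hg]
  rw [← integral_neg_eq_self]
  simp [Real.fourierInv_eq_fourier_neg, ← Real.fourierInv_eq_fourier_comp_neg]

theorem continuous_fourier {f : R3 → ℂ} (hf : Integrable f) : Continuous (𝓕 f) :=
  VectorFourier.fourierIntegral_continuous Real.continuous_fourierChar
    (L := innerₗ R3) continuous_inner hf

theorem continuous_fourierInv {f : R3 → ℂ} (hf : Integrable f) : Continuous (𝓕⁻ f) := by
  rw [Real.fourierInv_eq_fourier_comp_neg]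
  exact continuous_fourier hf.comp_neg

/-- The Fourier transforms on `L¹` and `L²` agree on `L¹ ∩ L²`. -/
theorem coeFn_fourier_toLp {f : R3 → ℂ} (hf : Integrable f) (hf2 : MemLp f 2) :
    (𝓕 (hf2.toLp f) : L2) =ᵐ[volume] 𝓕 f := by
  refine ae_eq_of_forall_schwartz (locallyIntegrable_L2 _)
    (continuous_fourier hf).locallyIntegrable fun u => ?_
  rw [← toDist_apply, ← fourier_toDist, TemperedDistribution.fourier_apply, toDist_apply]
  have h := integral_fourier_mul_comm u.integrable hf
  rw [← h, ← SchwartzMap.fourier_coe]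
  exact integral_congr_ae (hf2.coeFn_toLp.mono fun x hx => by simp only [hx])

theorem coeFn_fourierInv_toLp {f : R3 → ℂ} (hf : Integrable f) (hf2 : MemLp f 2) :
    (𝓕⁻ (hf2.toLp f) : L2) =ᵐ[volume] 𝓕⁻ f := by
  refine ae_eq_of_forall_schwartz (locallyIntegrable_L2 _)
    (continuous_fourierInv hf).locallyIntegrable fun u => ?_
  rw [← toDist_apply, ← fourierInv_toDist, TemperedDistribution.fourierInv_apply, toDist_apply]
  have h := integral_fourierInv_mul_comm u.integrable hf
  rw [← h, ← SchwartzMap.fourierInv_coe]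
  exact integral_congr_ae (hf2.coeFn_toLp.mono fun x hx => by simp only [hx])

/-- The distributional Laplacian in Fourier variables. -/
theorem toDist_eq_laplacian_iff (g h : L2) :
    toDist h = Δ (toDist g) ↔
      (𝓕 h : L2) =ᵐ[volume] fun ξ => -((2 * Real.pi) ^ 2 * ‖ξ‖ ^ 2 : ℝ) * (𝓕 g : L2) ξ := by
  have e1 : toDist h = Δ (toDist g) ↔ 𝓕 (toDist h) = 𝓕 (Δ (toDist g)) :=
    (FourierTransform.fourierEquiv ℂ 𝓢'(R3, ℂ)).injective.eq_iff.symm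
  have e2 : ∀ u : 𝓢(R3, ℂ), 𝓕 (Δ (toDist g)) u =
      ∫ ξ, u ξ * (-((2 * Real.pi) ^ 2 * ‖ξ‖ ^ 2 : ℝ) * (𝓕 g : L2) ξ) := by
    intro u
    have ht : (fun x : R3 => Complex.ofReal (‖x‖ ^ 2)).HasTemperateGrowth := by fun_prop
    rw [TemperedDistribution.laplacian_eq_fourierMultiplierCLM,
      TemperedDistribution.fourierMultiplierCLM_apply, ← Complex.coe_smul,
      FourierTransform.fourier_smul,
      FourierTransform.fourier_fourierInv_eq, fourier_toDist]
    simp only [smul_apply,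
      TemperedDistribution.smulLeftCLM_apply_apply, toDist_apply]
    rw [smul_eq_mul, ← integral_const_mul]
    congr 1
    ext ξ
    rw [SchwartzMap.smulLeftCLM_apply_apply ht]
    simp only [smul_eq_mul]
    push_cast
    ring
  rw [e1, fourier_toDist]
  constructor
  · intro H
    refine ae_eq_of_forall_schwartz (locallyIntegrable_L2 _) ?_ fun u => ?_
    · rw [← locallyIntegrableOn_univ]
      refine LocallyIntegrableOn.continuousOn_mul
        (locallyIntegrableOn_univ.mpr (locallyIntegrable_L2 _)) ?_ isOpen_univ.isLocallyClosed
      fun_prop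
    · rw [← e2, ← H, toDist_apply]
  · intro H
    ext u
    rw [e2, toDist_apply]
    exact integral_congr_ae (H.mono fun ξ hξ => by simp only [hξ])

/-- The Bessel potential of order two is the multiplier `1 + |ξ|²`, so it needs only `g` and its
Laplacian in `L²`. -/
theorem mem_sobolevH2_of_laplacian {g h : L2} (H : toDist h = Δ (toDist g)) : g ∈ sobolevH2 := by
  change TemperedDistribution.MemSobolev 2 2 (toDist g)
  have ht : (fun x : R3 => Complex.ofReal (‖x‖ ^ 2)).HasTemperateGrowth := by fun_prop
  have h1 : TemperedDistribution.fourierMultiplierCLM ℂ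
      (fun x : R3 => Complex.ofReal (‖x‖ ^ 2)) (toDist g) =
        toDist ((-(2 * Real.pi) ^ 2 : ℂ)⁻¹ • h) := by
    rw [map_smul, H, TemperedDistribution.laplacian_eq_fourierMultiplierCLM, ← Complex.coe_smul,
      smul_smul]
    push_cast
    rw [inv_mul_cancel₀, one_smul]
    simp [Real.pi_ne_zero]
  -- In the convention with `2π` in the exponent, `|ξ|²` is the symbol of `-(2π)⁻²Δ`.
  refine ⟨g + (-(2 * Real.pi) ^ 2 : ℂ)⁻¹ • h, ?_⟩
  change _ = toDist _
  rw [map_add, ← h1, TemperedDistribution.besselPotential,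
    TemperedDistribution.fourierMultiplierCLM_apply,
    TemperedDistribution.fourierMultiplierCLM_apply]
  have h2 : (fun x : R3 => (((1 + ‖x‖ ^ 2) ^ ((2 : ℝ) / 2) : ℝ) : ℂ)) =
      (fun _ => (1 : ℂ)) + fun x => Complex.ofReal (‖x‖ ^ 2) := by
    ext x; simp
  rw [h2, TemperedDistribution.smulLeftCLM_add (by fun_prop) ht]
  simp [FourierTransform.fourierInv_add]

theorem laplacianH2_spec (g : sobolevH2) : toDist (laplacianH2 g) = Δ (toDist (g : L2)) :=
  (exists_laplacian g).choose_spec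

end ZeroEnergy

/-! ### Neutral charge densities and the Fourier transform of their potentials. -/

namespace ZeroEnergy

open FourierTransform Real

/-- Superposition of a family of nonnegative kernels may be interchanged with an integral. -/
theorem integral_superposition {α : Type*} [MeasurableSpace α] {μ : Measure α} [SFinite μ]
    {k : α → ℝ → ℝ} {K : α → ℝ} {a : α → ℂ} (hk : Measurable (Function.uncurry k))
    (hpos : ∀ y, ∀ t, 0 < t → 0 ≤ k y t)
    (hK : ∀ᵐ y ∂μ, IntegrableOn (k y) (Set.Ioi 0) ∧ ∫ t in Set.Ioi 0, k y t = K y)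
    (ha : AEStronglyMeasurable a μ) (hint : Integrable (fun y => (K y : ℂ) * a y) μ) :
    ∫ y, (K y : ℂ) * a y ∂μ = ∫ t in Set.Ioi (0 : ℝ), ∫ y, (k y t : ℂ) * a y ∂μ := by
  have hm : AEStronglyMeasurable (fun p : α × ℝ => (k p.1 p.2 : ℂ) * a p.1)
      (μ.prod (volume.restrict (Set.Ioi 0))) :=
    (Complex.measurable_ofReal.comp hk).aestronglyMeasurable.mul ha.comp_fst
  have hI : Integrable (fun p : α × ℝ => (k p.1 p.2 : ℂ) * a p.1)
      (μ.prod (volume.restrict (Set.Ioi 0))) := by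
    rw [integrable_prod_iff hm]
    refine ⟨hK.mono fun y hy => (hy.1.ofReal (𝕜 := ℂ)).mul_const (a y), hint.norm.congr ?_⟩
    filter_upwards [hK] with y hy
    -- Since the kernels are nonnegative, taking absolute values loses nothing, and integrability on
    -- the product reduces to `hint`.
    have h1 : ∫ t in Set.Ioi (0 : ℝ), ‖(k y t : ℂ) * a y‖ = K y * ‖a y‖ := by
      rw [← hy.2, ← integral_mul_const]
      refine setIntegral_congr_fun measurableSet_Ioi fun t ht => ?_
      simp only [norm_mul, Complex.norm_real, norm_of_nonneg (hpos y t ht)]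
    have h2 : 0 ≤ K y := hy.2 ▸ setIntegral_nonneg measurableSet_Ioi fun t ht => hpos y t ht
    rw [h1, norm_mul, Complex.norm_real, norm_of_nonneg h2]
  rw [← integral_integral_swap hI]
  refine integral_congr_ae (hK.mono fun y hy => ?_)
  simp only
  rw [integral_mul_const, integral_complex_ofReal, hy.2]

theorem integrable_star {α : Type*} [MeasurableSpace α] {μ : Measure α} {f : α → ℂ}
    (hf : Integrable f μ) : Integrable (fun x => star (f x)) μ :=
  hf.mono (continuous_star.comp_aestronglyMeasurable hf.1) (ae_of_all _ fun x => by simp)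

/-- A charge density with finite first moment and total charge zero. -/
structure IsNeutral (ρ : R3 → ℂ) : Prop where
  integrable_bracket_mul : Integrable fun x => (bracket x : ℂ) * ρ x
  memLp_bracket_mul : MemLp (fun x => (bracket x : ℂ) * ρ x) 2
  integral_eq_zero : ∫ x, ρ x = 0

/-- The Fourier transform of the potential `G₀ ρ`. -/
noncomputable def greenHat (ρ : R3 → ℂ) (ξ : R3) : ℂ := ((4 * π ^ 2 * ‖ξ‖ ^ 2 : ℝ) : ℂ)⁻¹ * 𝓕 ρ ξ

theorem aestronglyMeasurable_of_bracket_mul {ρ : R3 → ℂ}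
    (h : AEStronglyMeasurable (fun x => (bracket x : ℂ) * ρ x)) : AEStronglyMeasurable ρ := by
  have hb : Continuous fun x : R3 => (bracket x : ℂ)⁻¹ :=
    (Complex.continuous_ofReal.comp continuous_bracket).inv₀ fun x => by
      simpa using (bracket_pos x).ne'
  refine (hb.aestronglyMeasurable.mul h).congr (ae_of_all _ fun x => ?_)
  have : (bracket x : ℂ) ≠ 0 := by simpa using (bracket_pos x).ne'
  simp only [Pi.mul_apply]
  field_simp

theorem norm_le_norm_bracket_mul (ρ : R3 → ℂ) (x : R3) : ‖ρ x‖ ≤ ‖(bracket x : ℂ) * ρ x‖ := by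
  rw [norm_mul, Complex.norm_real, norm_of_nonneg (bracket_pos x).le]
  exact le_mul_of_one_le_left (norm_nonneg _) (one_le_bracket x)

namespace IsNeutral

variable {ρ : R3 → ℂ}

theorem aestronglyMeasurable (h : IsNeutral ρ) : AEStronglyMeasurable ρ :=
  aestronglyMeasurable_of_bracket_mul h.1.1

theorem integrable (h : IsNeutral ρ) : Integrable ρ :=
  h.1.mono h.aestronglyMeasurable (ae_of_all _ (norm_le_norm_bracket_mul ρ))

theorem memLp (h : IsNeutral ρ) : MemLp ρ 2 :=
  h.2.mono h.aestronglyMeasurable (ae_of_all _ (norm_le_norm_bracket_mul ρ))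

/-- Neutrality allows `1` to be subtracted from the exponential, and `|exp(iθ) - 1| ≤ |θ|` then
costs one moment of `ρ`. -/
theorem norm_fourier_le (h : IsNeutral ρ) (ξ : R3) :
    ‖𝓕 ρ ξ‖ ≤ (2 * π * ∫ x, ‖(bracket x : ℂ) * ρ x‖) * ‖ξ‖ := by
  have h1 : 𝓕 ρ ξ = ∫ x, (Complex.exp (((-2 * π * inner ℝ x ξ : ℝ) : ℂ) * Complex.I) - 1) * ρ x := by
    have hi : Integrable fun x =>
        Complex.exp (((-2 * π * inner ℝ x ξ : ℝ) : ℂ) * Complex.I) * ρ x := by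
      refine h.integrable.mono (Continuous.aestronglyMeasurable (by fun_prop) |>.mul
        h.aestronglyMeasurable) (ae_of_all _ fun x => ?_)
      rw [norm_mul, Complex.norm_exp_ofReal_mul_I, one_mul]
    simp only [sub_mul, one_mul]
    rw [integral_sub hi h.integrable, h.integral_eq_zero, sub_zero, Real.fourier_eq']
    rfl
  rw [h1, mul_assoc, mul_comm (∫ x, _), ← mul_assoc, ← integral_const_mul]
  refine norm_integral_le_of_norm_le (h.1.norm.const_mul _) (ae_of_all _ fun x => ?_)
  rw [norm_mul, norm_mul, Complex.norm_real, norm_of_nonneg (bracket_pos x).le, mul_comm _ Complex.I]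
  have h2 := norm_exp_I_mul_ofReal_sub_one_le (x := -2 * π * inner ℝ x ξ)
  have h3 : ‖-2 * π * inner ℝ x ξ‖ ≤ 2 * π * (‖x‖ * ‖ξ‖) := by
    rw [norm_mul, norm_mul, norm_neg, norm_of_nonneg pi_pos.le]
    gcongr
    · simp
    · exact norm_inner_le_norm x ξ
  calc _ ≤ (2 * π * (‖x‖ * ‖ξ‖)) * ‖ρ x‖ := by gcongr; exact h2.trans h3
    _ ≤ (2 * π * (bracket x * ‖ξ‖)) * ‖ρ x‖ := by gcongr; exact norm_le_bracket x
    _ = _ := by ring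

theorem memLp_fourier (h : IsNeutral ρ) : MemLp (𝓕 ρ) 2 :=
  (memLp_congr_ae (coeFn_fourier_toLp h.integrable h.memLp)).mp (Lp.memLp _)

end IsNeutral

theorem measurable_greenHat {ρ : R3 → ℂ} (h : Integrable ρ) : Measurable (greenHat ρ) := by
  unfold greenHat
  have := (continuous_fourier h).measurable
  fun_prop

namespace IsNeutral

variable {ρ : R3 → ℂ}

theorem norm_greenHat (ξ : R3) : ‖greenHat ρ ξ‖ = (4 * π ^ 2 * ‖ξ‖ ^ 2)⁻¹ * ‖𝓕 ρ ξ‖ := by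
  rw [greenHat, norm_mul, norm_inv, Complex.norm_real, norm_of_nonneg (by positivity)]

theorem one_le_four_pi_sq : (1 : ℝ) ≤ 4 * π ^ 2 := by nlinarith [pi_gt_three]

theorem exists_norm_greenHat_le (h : IsNeutral ρ) :
    ∃ C : ℝ, 0 ≤ C ∧ ∀ ξ, ‖greenHat ρ ξ‖ ≤ C * ‖ξ‖⁻¹ := by
  set C := (2 * π * ∫ x, ‖(bracket x : ℂ) * ρ x‖)
  have hC : 0 ≤ C := by
    have : 0 ≤ ∫ x, ‖(bracket x : ℂ) * ρ x‖ := integral_nonneg fun _ => norm_nonneg _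
    positivity
  refine ⟨C, hC, fun ξ => ?_⟩
  rw [norm_greenHat]
  rcases eq_or_ne ξ 0 with rfl | hξ
  · simp
  have h0 : 0 < ‖ξ‖ := norm_pos_iff.mpr hξ
  calc _ ≤ (1 * ‖ξ‖ ^ 2)⁻¹ * (C * ‖ξ‖) := by
        gcongr
        · exact one_le_four_pi_sq
        · exact h.norm_fourier_le ξ
    _ = C * ‖ξ‖⁻¹ := by field_simp

theorem norm_greenHat_le_norm_fourier {ξ : R3} (hξ : 1 ≤ ‖ξ‖) :
    ‖greenHat ρ ξ‖ ≤ (‖ξ‖ ^ 2)⁻¹ * ‖𝓕 ρ ξ‖ := by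
  rw [norm_greenHat]
  have := one_le_four_pi_sq
  gcongr
  nlinarith [sq_nonneg ‖ξ‖]

theorem integrable_indicator_inv_norm_sq :
    Integrable ((Metric.ball (0 : R3) 1).indicator (fun z => (‖z‖ ^ 2)⁻¹)) :=
  (integrable_indicator_iff measurableSet_ball).mpr integrableOn_ball_norm_zpow_neg_two

/-- Near the origin the bound `C|ξ|⁻¹` is square integrable in dimension three; outside the unit
ball `𝓕 ρ` itself dominates. -/
theorem memLp_greenHat (h : IsNeutral ρ) : MemLp (greenHat ρ) 2 := by
  obtain ⟨C, hC, hle⟩ := h.exists_norm_greenHat_le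
  have hm := (measurable_greenHat h.integrable).aestronglyMeasurable (μ := volume)
  rw [memLp_two_iff_integrable_sq_norm hm]
  have h2 := (memLp_two_iff_integrable_sq_norm h.memLp_fourier.1).mp h.memLp_fourier
  refine ((integrable_indicator_inv_norm_sq.const_mul (C ^ 2)).add h2).mono' (hm.norm.pow 2)
    (ae_of_all _ fun ξ => ?_)
  rw [norm_of_nonneg (by positivity), Pi.add_apply]
  by_cases hξ : ξ ∈ Metric.ball (0 : R3) 1
  · rw [Set.indicator_of_mem hξ, ← inv_pow, ← mul_pow]
    have := pow_le_pow_left₀ (norm_nonneg _) (hle ξ) 2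
    nlinarith [sq_nonneg ‖𝓕 ρ ξ‖]
  · rw [Set.indicator_of_notMem hξ, mul_zero, zero_add]
    have h1 : 1 ≤ ‖ξ‖ := by simpa using hξ
    refine pow_le_pow_left₀ (norm_nonneg _) ((norm_greenHat_le_norm_fourier h1).trans ?_) 2
    exact mul_le_of_le_one_left (norm_nonneg _) (inv_le_one_of_one_le₀ (one_le_pow₀ h1))

/-- At infinity the product `|ξ|⁻² |𝓕ρ|` is bounded by `|𝓕ρ|² + |ξ|⁻⁴`, and `4 > 3`. -/
theorem integrable_greenHat (h : IsNeutral ρ) : Integrable (greenHat ρ) := by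
  obtain ⟨C, hC, hle⟩ := h.exists_norm_greenHat_le
  have hm := (measurable_greenHat h.integrable).aestronglyMeasurable (μ := volume)
  have h2 := (memLp_two_iff_integrable_sq_norm h.memLp_fourier.1).mp h.memLp_fourier
  have h3 := (integrable_bracket_rpow (s := 4) (by norm_num)).const_mul 4
  refine ((integrable_indicator_inv_norm_sq.const_mul C).add (h2.add h3)).mono' hm
    (ae_of_all _ fun ξ => ?_)
  have p := bracket_rpow_pos ξ (-4)
  simp only [Pi.add_apply]
  by_cases hξ : ξ ∈ Metric.ball (0 : R3) 1
  · rw [Set.indicator_of_mem hξ]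
    have h1 : ‖ξ‖ < 1 := by simpa using hξ
    have : C * ‖ξ‖⁻¹ ≤ C * (‖ξ‖ ^ 2)⁻¹ := by
      rcases eq_or_ne ξ 0 with rfl | hξ0
      · simp
      have h0 : 0 < ‖ξ‖ := norm_pos_iff.mpr hξ0
      gcongr
      nlinarith
    nlinarith [sq_nonneg ‖𝓕 ρ ξ‖, hle ξ]
  · rw [Set.indicator_of_notMem hξ, mul_zero, zero_add]
    have h1 : 1 ≤ ‖ξ‖ := by simpa using hξ
    -- The factor `4` is the square of `2` in `1 + |ξ|² ≤ 2|ξ|²`.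
    have h4 : ((‖ξ‖ ^ 2)⁻¹) ^ 2 ≤ 4 * bracket ξ ^ (-4 : ℝ) := by
      have hb := bracket_pos ξ
      rw [rpow_neg hb.le, show bracket ξ ^ (4 : ℝ) = (bracket ξ ^ 2) ^ 2 by
        rw [← pow_mul]; norm_cast, bracket_sq, ← div_eq_mul_inv, inv_pow, inv_eq_one_div,
        div_le_div_iff₀ (by positivity) (by positivity)]
      have := one_le_pow₀ h1 (n := 2)
      nlinarith
    nlinarith [norm_greenHat_le_norm_fourier (ρ := ρ) h1,
      sq_nonneg ((‖ξ‖ ^ 2)⁻¹ - ‖𝓕 ρ ξ‖), sq_nonneg ‖𝓕 ρ ξ‖]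

end IsNeutral

/-- The heat semigroup in position and Fourier variables. -/
theorem integral_gaussian_mul {f : R3 → ℂ} (hf : Integrable f) {t : ℝ} (ht : 0 < t) (x : R3) :
    ∫ y, ((t ^ (-3 / 2 : ℝ) * exp (-(π * ‖x - y‖ ^ 2 / t)) : ℝ) : ℂ) * f y =
      ∫ ξ, ((exp (-(π * ‖ξ‖ ^ 2 * t)) : ℝ) : ℂ) *
        (Complex.exp (((2 * π * inner ℝ ξ x : ℝ) : ℂ) * Complex.I) * 𝓕 f ξ) := by
  have hb : 0 < ((π * t : ℝ) : ℂ).re := by simp only [Complex.ofReal_re]; positivity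
  have hg := GaussianFourier.integrable_cexp_neg_mul_sq_norm_add hb (2 * π * Complex.I) x
  have h := integral_fourier_mul_comm hg hf
  -- The modulation by `exp(2πi⟨x, v⟩)` recentres the transformed Gaussian at `x`.
  have e1 : ∀ w, 𝓕 (fun v : R3 => Complex.exp (-((π * t : ℝ) : ℂ) * ‖v‖ ^ 2 +
      2 * π * Complex.I * inner ℝ x v)) w =
        ((t ^ (-3 / 2 : ℝ) * exp (-(π * ‖x - w‖ ^ 2 / t)) : ℝ) : ℂ) := by
    intro w
    rw [fourier_gaussian_innerProductSpace' hb x w, finrank_R3]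
    push_cast
    congr 1
    · rw [Complex.ofReal_cpow ht.le]
      have : (π : ℂ) / (π * t) = ((t⁻¹ : ℝ) : ℂ) := by
        have := pi_ne_zero
        push_cast; field_simp
      rw [this]
      rw [Complex.ofReal_inv, Complex.inv_cpow]
      · rw [← Complex.cpow_neg]; congr 1; norm_num
      · rw [Complex.arg_ofReal_of_nonneg ht.le]; exact pi_pos.ne
    · congr 1
      have := pi_ne_zero
      have := ht.ne'
      field_simp
  simp only [e1] at h
  rw [h]
  congr 1
  ext ξ
  rw [← mul_assoc, Complex.ofReal_exp, ← Complex.exp_add, real_inner_comm ξ x]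
  congr 2
  push_cast
  ring

end ZeroEnergy

/-! ### The potential and the energy of neutral densities in Fourier variables. -/

namespace ZeroEnergy

open FourierTransform Real

theorem kerG_zero (x y : R3) : kerG 0 x y = (4 * π)⁻¹ * ‖x - y‖⁻¹ := by
  simp [kerG, div_eq_mul_inv]
  ring

theorem kerG_one (x y : R3) : kerG 1 x y = (4 * π)⁻¹ := by
  simp [kerG, div_eq_mul_inv]

theorem kerG_two (x y : R3) : kerG 2 x y = (8 * π)⁻¹ * ‖x - y‖ := by
  simp [kerG, div_eq_mul_inv, show (2 : ℤ) - 1 = 1 by norm_num]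
  ring

theorem fourierInv_eq_integral_exp (f : R3 → ℂ) (x : R3) :
    𝓕⁻ f x = ∫ ξ, Complex.exp (((2 * π * inner ℝ ξ x : ℝ) : ℂ) * Complex.I) * f ξ := by
  rw [Real.fourierInv_eq']; rfl

theorem ae_norm_pos : ∀ᵐ ξ : R3, 0 < ‖ξ‖ := by
  have : ∀ᵐ ξ : R3, ξ ≠ 0 := by simp [ae_iff]
  exact this.mono fun ξ h => norm_pos_iff.mpr h

theorem ae_norm_sub_pos (x : R3) : ∀ᵐ y : R3, 0 < ‖x - y‖ := by
  have : ∀ᵐ y : R3, y ≠ x := by simp [ae_iff]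
  exact this.mono fun ξ h => norm_pos_iff.mpr (sub_ne_zero.mpr h.symm)

/-- The potential of a neutral density is an absolutely convergent Fourier integral. -/
theorem applyG0_eq_fourierInv {ρ : R3 → ℂ} (h : IsNeutral ρ) (x : R3)
    (hx : Integrable fun y => (kerG 0 x y : ℂ) * ρ y) :
    applyG0 ρ x = 𝓕⁻ (greenHat ρ) x := by
  have hx' : Integrable fun y => ((‖x - y‖⁻¹ : ℝ) : ℂ) * ρ y := by
    refine (hx.const_mul ((4 * π : ℝ) : ℂ)).congr (ae_of_all _ fun y => ?_)
    have := pi_ne_zero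
    simp only [kerG_zero]
    push_cast
    field_simp
  -- `s1` and `s2` write the position and the Fourier side as integrals over the same `t`;
  -- `integral_gaussian_mul` identifies the integrands.
  have s1 := integral_superposition
    (k := fun (y : R3) (t : ℝ) => t ^ (-3 / 2 : ℝ) * exp (-(π * ‖x - y‖ ^ 2 / t)))
    (K := fun y => ‖x - y‖⁻¹) (by fun_prop) (fun y t ht => by positivity)
    ((ae_norm_sub_pos x).mono fun y hy =>
      ⟨integrableOn_gaussian_scale hy, integral_gaussian_scale hy⟩)
    h.aestronglyMeasurable hx'
  have hg : (fun ξ => (((π * ‖ξ‖ ^ 2)⁻¹ : ℝ) : ℂ) *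
      (Complex.exp (((2 * π * inner ℝ ξ x : ℝ) : ℂ) * Complex.I) * 𝓕 ρ ξ)) =
      fun ξ => ((4 * π : ℝ) : ℂ) *
        (Complex.exp (((2 * π * inner ℝ ξ x : ℝ) : ℂ) * Complex.I) * greenHat ρ ξ) := by
    ext ξ
    simp only [greenHat]
    have := pi_ne_zero
    push_cast
    field_simp
  have hm : AEStronglyMeasurable
      fun ξ : R3 => Complex.exp (((2 * π * inner ℝ ξ x : ℝ) : ℂ) * Complex.I) :=
    Continuous.aestronglyMeasurable (by fun_prop)
  have hi : Integrable fun ξ : R3 =>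
      Complex.exp (((2 * π * inner ℝ ξ x : ℝ) : ℂ) * Complex.I) * greenHat ρ ξ := by
    refine h.integrable_greenHat.mono (hm.mul h.integrable_greenHat.1) (ae_of_all _ fun ξ => ?_)
    rw [norm_mul, Complex.norm_exp_ofReal_mul_I, one_mul]
  have s2 := integral_superposition
    (k := fun (ξ : R3) (t : ℝ) => exp (-(π * ‖ξ‖ ^ 2 * t)))
    (K := fun ξ => (π * ‖ξ‖ ^ 2)⁻¹) (by fun_prop) (fun y t ht => by positivity)
    (ae_norm_pos.mono fun y hy =>
      ⟨integrableOn_exp_neg_scale hy, integral_exp_neg_scale hy⟩)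
    (hm.mul (continuous_fourier h.integrable).aestronglyMeasurable)
    (by rw [show (fun y => (((π * ‖y‖ ^ 2)⁻¹ : ℝ) : ℂ) * ((fun ξ : R3 =>
          Complex.exp (((2 * π * inner ℝ ξ x : ℝ) : ℂ) * Complex.I)) * 𝓕 ρ) y) = _ from hg]
        exact hi.const_mul _)
  have s3 : ∫ y, ((‖x - y‖⁻¹ : ℝ) : ℂ) * ρ y = ∫ ξ, (((π * ‖ξ‖ ^ 2)⁻¹ : ℝ) : ℂ) *
      (Complex.exp (((2 * π * inner ℝ ξ x : ℝ) : ℂ) * Complex.I) * 𝓕 ρ ξ) := by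
    refine s1.trans (Eq.trans ?_ s2.symm)
    exact setIntegral_congr_fun measurableSet_Ioi fun t ht => integral_gaussian_mul h.integrable ht x
  have e : applyG0 ρ x = (((4 * π)⁻¹ : ℝ) : ℂ) * ∫ y, ((‖x - y‖⁻¹ : ℝ) : ℂ) * ρ y := by
    simp only [applyG0, kerG_zero, Complex.ofReal_mul (4 * π)⁻¹, mul_assoc]
    rw [integral_const_mul]
  rw [e, fourierInv_eq_integral_exp, s3, hg, integral_const_mul, ← mul_assoc, ← Complex.ofReal_mul,
    inv_mul_cancel₀ (by positivity), Complex.ofReal_one, one_mul]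

/-- The heat-regularized energy of two densities. -/
theorem integral_exp_mul_star_fourier {ρ₁ ρ₂ : R3 → ℂ} (h₁ : Integrable ρ₁) (h₂ : Integrable ρ₂)
    {t : ℝ} (ht : 0 < t) :
    ∫ ξ, ((exp (-(π * ‖ξ‖ ^ 2 * t)) : ℝ) : ℂ) * (star (𝓕 ρ₁ ξ) * 𝓕 ρ₂ ξ) =
      ∫ x, star (ρ₁ x) *
        ∫ y, ((t ^ (-3 / 2 : ℝ) * exp (-(π * ‖x - y‖ ^ 2 / t)) : ℝ) : ℂ) * ρ₂ y := by
  have hs : Integrable fun x => star (ρ₁ x) := integrable_star h₁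
  have e1 : ∀ ξ, 𝓕⁻ (fun x => star (ρ₁ x)) ξ = star (𝓕 ρ₁ ξ) := by
    intro ξ
    rw [fourierInv_eq_integral_exp, Real.fourier_eq', ← starRingEnd_apply, ← integral_conj]
    congr 1
    ext x
    simp [← Complex.exp_conj, Complex.conj_ofNat]
  have hG : Integrable fun ξ => ((exp (-(π * ‖ξ‖ ^ 2 * t)) : ℝ) : ℂ) * 𝓕 ρ₂ ξ := by
    have hb : 0 < ((π * t : ℝ) : ℂ).re := by simp only [Complex.ofReal_re]; positivity
    have hg := GaussianFourier.integrable_cexp_neg_mul_sq_norm_add hb 0 (0 : R3)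
    refine (hg.mul_bdd (c := ∫ y, ‖ρ₂ y‖) (continuous_fourier h₂).aestronglyMeasurable
      (ae_of_all _ fun ξ => ?_)).congr (ae_of_all _ fun ξ => ?_)
    · exact VectorFourier.norm_fourierIntegral_le_integral_norm _ _ _ _ _
    · simp only
      congr 1
      push_cast
      congr 1
      simp
      ring
  have h := integral_fourierInv_mul_comm hs hG
  simp only [e1] at h
  calc _ = ∫ ξ, star (𝓕 ρ₁ ξ) * (((exp (-(π * ‖ξ‖ ^ 2 * t)) : ℝ) : ℂ) * 𝓕 ρ₂ ξ) := by
        congr 1; ext ξ; ring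
    _ = _ := by
      rw [h]
      congr 1; ext x
      rw [integral_gaussian_mul h₂ ht x, fourierInv_eq_integral_exp]
      congr 2; ext ξ; ring

theorem measurable_kernel_aux : Measurable (Function.uncurry fun (p : R3 × R3) (t : ℝ) =>
    t ^ (-1 / 2 : ℝ) * (1 - exp (-(π * ‖p.1 - p.2‖ ^ 2 / t)))) := by
  unfold Function.uncurry
  fun_prop

theorem integrable_gaussian_mul {f : R3 → ℂ} (hf : Integrable f) {t : ℝ} (ht : 0 < t) (x : R3) :
    Integrable fun y => ((t ^ (-3 / 2 : ℝ) * exp (-(π * ‖x - y‖ ^ 2 / t)) : ℝ) : ℂ) * f y := by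
  refine hf.bdd_mul (c := t ^ (-3 / 2 : ℝ)) (Measurable.aestronglyMeasurable (by fun_prop))
    (ae_of_all _ fun y => ?_)
  rw [Complex.norm_real, norm_of_nonneg (by positivity)]
  refine mul_le_of_le_one_right (by positivity) (exp_le_one_iff.mpr ?_)
  rw [neg_nonpos]
  positivity

theorem norm_sub_le_bracket_mul (x y : R3) : ‖x - y‖ ≤ 2 * (bracket x * bracket y) := by
  have h1 := norm_sub_le x y
  have h2 := norm_le_bracket x
  have h3 := norm_le_bracket y
  have h4 := one_le_bracket x
  have h5 := one_le_bracket y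
  nlinarith

theorem integrable_prod_norm_sub_mul {ρ₁ ρ₂ : R3 → ℂ} (h₁ : IsNeutral ρ₁) (h₂ : IsNeutral ρ₂) :
    Integrable fun p : R3 × R3 => (‖p.1 - p.2‖ : ℂ) * (star (ρ₁ p.1) * ρ₂ p.2) := by
  have hp := (h₁.1.mul_prod h₂.1).norm.const_mul 2
  refine hp.mono' (AEStronglyMeasurable.mul (Continuous.aestronglyMeasurable (by fun_prop))
    ((integrable_star h₁.integrable).mul_prod h₂.integrable).1) (ae_of_all _ fun p => ?_)
  have b1 := bracket_pos p.1
  have b2 := bracket_pos p.2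
  simp only [norm_mul, norm_star, Complex.norm_real, norm_norm, norm_of_nonneg b1.le,
    norm_of_nonneg b2.le]
  calc _ ≤ (2 * (bracket p.1 * bracket p.2)) * (‖ρ₁ p.1‖ * ‖ρ₂ p.2‖) := by
        gcongr; exact norm_sub_le_bracket_mul _ _
    _ = _ := by ring

/-- The electrostatic energy of neutral densities: `⟨G₀ρ₁, G₀ρ₂⟩ = -⟨ρ₁, G₂ρ₂⟩`. -/
theorem integral_star_greenHat_mul {ρ₁ ρ₂ : R3 → ℂ} (h₁ : IsNeutral ρ₁) (h₂ : IsNeutral ρ₂) :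
    ∫ ξ, star (greenHat ρ₁ ξ) * greenHat ρ₂ ξ =
      -∫ p : R3 × R3, (kerG 2 p.1 p.2 : ℂ) * (star (ρ₁ p.1) * ρ₂ p.2) := by
  have hg : (fun ξ => ((((π * ‖ξ‖ ^ 2) ^ 2)⁻¹ : ℝ) : ℂ) * (star (𝓕 ρ₁ ξ) * 𝓕 ρ₂ ξ)) =
      fun ξ => ((16 * π ^ 2 : ℝ) : ℂ) * (star (greenHat ρ₁ ξ) * greenHat ρ₂ ξ) := by
    ext ξ
    have := pi_ne_zero
    simp only [greenHat, ← starRingEnd_apply, map_mul, map_inv₀, Complex.conj_ofReal]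
    push_cast
    field_simp
    ring
  have hi : Integrable fun ξ => star (greenHat ρ₁ ξ) * greenHat ρ₂ ξ :=
    h₁.memLp_greenHat.star.integrable_mul h₂.memLp_greenHat
  have s1 := integral_superposition
    (k := fun (ξ : R3) (t : ℝ) => t * exp (-(π * ‖ξ‖ ^ 2 * t)))
    (K := fun ξ => ((π * ‖ξ‖ ^ 2) ^ 2)⁻¹) (a := fun ξ => star (𝓕 ρ₁ ξ) * 𝓕 ρ₂ ξ)
    (by fun_prop) (fun y t ht => by positivity)
    (ae_norm_pos.mono fun y hy =>
      ⟨integrableOn_mul_exp_neg_scale hy, integral_mul_exp_neg_scale hy⟩)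
    ((continuous_fourier h₁.integrable).star.mul
      (continuous_fourier h₂.integrable)).aestronglyMeasurable
    (by rw [hg]; exact hi.const_mul _)
  have hK : Integrable fun p : R3 × R3 =>
      ((2 * π * ‖p.1 - p.2‖ : ℝ) : ℂ) * (star (ρ₁ p.1) * ρ₂ p.2) := by
    refine ((integrable_prod_norm_sub_mul h₁ h₂).const_mul ((2 * π : ℝ) : ℂ)).congr
      (ae_of_all _ fun p => ?_)
    push_cast; ring
  -- A plain superposition of Gaussians would need the divergent weight `t · t^(-3/2)`. Subtracting
  -- the Gaussian from `1` makes it converge, at the price of a sign and a constant.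
  have s2 := integral_superposition (μ := (volume : Measure (R3 × R3)))
    (k := fun (p : R3 × R3) (t : ℝ) => t ^ (-1 / 2 : ℝ) * (1 - exp (-(π * ‖p.1 - p.2‖ ^ 2 / t))))
    (K := fun p => 2 * π * ‖p.1 - p.2‖) (a := fun p => star (ρ₁ p.1) * ρ₂ p.2)
    measurable_kernel_aux
    (fun y t ht => mul_nonneg (by positivity) (one_sub_exp_neg_div_nonneg (by positivity) ht))
    (ae_of_all _ fun y => ⟨integrableOn_rpow_mul_one_sub_exp (by positivity),
      integral_rpow_mul_one_sub_exp (norm_nonneg _)⟩)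
    ((integrable_star h₁.integrable).mul_prod h₂.integrable).1 hK
  have s3 : ∀ t : ℝ, 0 < t →
      ∫ ξ, ((t * exp (-(π * ‖ξ‖ ^ 2 * t)) : ℝ) : ℂ) * (star (𝓕 ρ₁ ξ) * 𝓕 ρ₂ ξ) =
      -∫ p : R3 × R3, ((t ^ (-1 / 2 : ℝ) * (1 - exp (-(π * ‖p.1 - p.2‖ ^ 2 / t))) : ℝ) : ℂ) *
        (star (ρ₁ p.1) * ρ₂ p.2) := by
    intro t ht
    have hI : Integrable fun p : R3 × R3 =>
        ((t ^ (-1 / 2 : ℝ) * (1 - exp (-(π * ‖p.1 - p.2‖ ^ 2 / t))) : ℝ) : ℂ) *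
        (star (ρ₁ p.1) * ρ₂ p.2) := by
      refine ((integrable_star h₁.integrable).mul_prod h₂.integrable).bdd_mul (c := t ^ (-1 / 2 : ℝ))
        (Measurable.aestronglyMeasurable (by fun_prop)) (ae_of_all _ fun p => ?_)
      have := one_sub_exp_neg_div_nonneg (c := π * ‖p.1 - p.2‖ ^ 2) (by positivity) ht
      rw [Complex.norm_real, norm_of_nonneg (by positivity)]
      have := exp_pos (-(π * ‖p.1 - p.2‖ ^ 2 / t))
      exact mul_le_of_le_one_right (by positivity) (by linarith)
    rw [Measure.volume_eq_prod, integral_prod _ hI, ← integral_neg]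
    have e : t * t ^ (-3 / 2 : ℝ) = t ^ (-1 / 2 : ℝ) := by
      rw [← rpow_one_add' ht.le (by norm_num)]; norm_num
    calc _ = (t : ℂ) * ∫ ξ, ((exp (-(π * ‖ξ‖ ^ 2 * t)) : ℝ) : ℂ) * (star (𝓕 ρ₁ ξ) * 𝓕 ρ₂ ξ) := by
          rw [← integral_const_mul]
          congr 1; ext ξ; push_cast; ring
      _ = _ := by
        rw [integral_exp_mul_star_fourier h₁.integrable h₂.integrable ht, ← integral_const_mul]
        congr 1; ext x
        -- Neutrality of `ρ₂`: the constant `1` introduced for convergence contributes nothing.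
        have hz : ∫ y, ((t ^ (-1 / 2 : ℝ) : ℝ) : ℂ) * (star (ρ₁ x) * ρ₂ y) = 0 := by
          rw [integral_const_mul, integral_const_mul, h₂.integral_eq_zero, mul_zero, mul_zero]
        rw [← sub_zero ((t : ℂ) * _), ← hz, ← integral_const_mul, ← integral_const_mul,
          ← integral_sub, ← integral_neg]
        · congr 1; ext y
          rw [← e]; push_cast; ring
        · exact ((integrable_gaussian_mul h₂.integrable ht x).const_mul _).const_mul _
        · exact (h₂.integrable.const_mul _).const_mul _
  have s4 : ∫ ξ, ((16 * π ^ 2 : ℝ) : ℂ) * (star (greenHat ρ₁ ξ) * greenHat ρ₂ ξ) =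
      -∫ p : R3 × R3, ((2 * π * ‖p.1 - p.2‖ : ℝ) : ℂ) * (star (ρ₁ p.1) * ρ₂ p.2) := by
    rw [← hg, s1, s2, ← integral_neg]
    exact setIntegral_congr_fun measurableSet_Ioi fun t ht => s3 t ht
  have hc : ((16 * π ^ 2 : ℝ) : ℂ) ≠ 0 := by
    have := pi_ne_zero
    rw [Complex.ofReal_ne_zero]; positivity
  rw [integral_const_mul] at s4
  apply mul_left_cancel₀ hc
  rw [s4, mul_neg, ← integral_const_mul]
  congr 2; ext p
  rw [kerG_two]
  have := pi_ne_zero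
  push_cast
  field_simp
  ring

end ZeroEnergy

/-! ### Hilbert–Schmidt operators and the consequences of the decay of `V`. -/

namespace ZeroEnergy

theorem integral_norm_mul_norm_le {f g : R3 → ℂ} (hf : MemLp f 2) (hg : MemLp g 2) :
    ∫ x, ‖f x‖ * ‖g x‖ ≤ √(∫ x, ‖f x‖ ^ 2) * √(∫ x, ‖g x‖ ^ 2) := by
  have h := integral_mul_norm_le_Lp_mul_Lq (μ := (volume : Measure R3)) (f := f) (g := g)
    Real.HolderConjugate.two_two (by simpa using hf) (by simpa using hg)
  simpa [Real.sqrt_eq_rpow] using h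

theorem norm_L2_sq (f : L2) : ‖f‖ ^ 2 = ∫ x, ‖f x‖ ^ 2 := by
  have h := inner_self_eq_norm_sq_to_K (𝕜 := ℂ) f
  rw [L2.inner_def] at h
  simp only [inner_self_eq_norm_sq_to_K] at h
  norm_cast at h
  exact h.symm

theorem norm_L2_eq (f : L2) : ‖f‖ = √(∫ x, ‖f x‖ ^ 2) := by
  rw [← norm_L2_sq, Real.sqrt_sq (norm_nonneg _)]

theorem integrable_sq_norm_L2 (f : L2) : Integrable fun x => ‖f x‖ ^ 2 :=
  (memLp_two_iff_integrable_sq_norm (Lp.memLp f).1).mp (Lp.memLp f)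

/-- A square integrable kernel defines a bounded operator. -/
theorem exists_hasKernel {K : R3 → R3 → ℝ} (hK : Measurable (Function.uncurry K))
    (hint : Integrable fun p : R3 × R3 => K p.1 p.2 ^ 2) : ∃ T, HasKernel K T := by
  have hKx : ∀ x, AEStronglyMeasurable fun y => (K x y : ℂ) := fun x =>
    (Complex.measurable_ofReal.comp (hK.comp measurable_prodMk_left)).aestronglyMeasurable
  have hmem : ∀ᵐ x : R3, MemLp (fun y => (K x y : ℂ)) 2 := by
    rw [Measure.volume_eq_prod] at hint
    filter_upwards [hint.prod_right_ae] with x hx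
    rw [memLp_two_iff_integrable_sq_norm (hKx x)]
    simpa using hx
  have hi : ∀ f : L2, ∀ᵐ x : R3, Integrable fun y => (K x y : ℂ) * f y := fun f =>
    hmem.mono fun x hx => hx.integrable_mul (Lp.memLp f)
  set A : R3 → ℝ := fun x => ∫ y, K x y ^ 2
  have hA : Integrable A := by
    rw [Measure.volume_eq_prod] at hint
    exact hint.integral_prod_left
  have hbd : ∀ f : L2, ∀ᵐ x : R3, ‖∫ y, (K x y : ℂ) * f y‖ ^ 2 ≤ A x * ‖f‖ ^ 2 := fun f =>
    hmem.mono fun x hx => by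
      have h1 : ‖∫ y, (K x y : ℂ) * f y‖ ≤ √(A x) * ‖f‖ := by
        refine (norm_integral_le_integral_norm _).trans ?_
        simp only [norm_mul]
        refine (integral_norm_mul_norm_le hx (Lp.memLp f)).trans ?_
        rw [← norm_L2_eq]
        simp [A]
      calc _ ≤ (√(A x) * ‖f‖) ^ 2 := by gcongr
        _ = _ := by rw [mul_pow, Real.sq_sqrt (integral_nonneg fun y => sq_nonneg _)]
  have hm : ∀ f : L2, AEStronglyMeasurable fun x => ∫ y, (K x y : ℂ) * f y := fun f =>
    AEStronglyMeasurable.integral_prod_right' (μ := volume) (ν := volume)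
      (f := fun p : R3 × R3 => (K p.1 p.2 : ℂ) * f p.2)
      ((Complex.measurable_ofReal.comp hK).aestronglyMeasurable.mul (Lp.memLp f).1.comp_snd)
  have hL : ∀ f : L2, MemLp (fun x => ∫ y, (K x y : ℂ) * f y) 2 := fun f => by
    rw [memLp_two_iff_integrable_sq_norm (hm f)]
    refine (hA.mul_const (‖f‖ ^ 2)).mono' ((hm f).norm.pow 2) ((hbd f).mono fun x hx => ?_)
    rwa [Real.norm_of_nonneg (by positivity)]
  let T₀ : L2 →ₗ[ℂ] L2 :=
    { toFun := fun f => (hL f).toLp _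
      map_add' := fun f g => by
        rw [← MemLp.toLp_add]
        refine MemLp.toLp_congr _ _ ?_
        filter_upwards [hi f, hi g] with x h1 h2
        rw [Pi.add_apply, ← integral_add h1 h2]
        refine integral_congr_ae ((Lp.coeFn_add f g).mono fun y hy => ?_)
        simp only [hy, Pi.add_apply, mul_add]
      map_smul' := fun c f => by
        rw [← MemLp.toLp_const_smul]
        refine MemLp.toLp_congr _ _ (ae_of_all _ fun x => ?_)
        rw [RingHom.id_apply, Pi.smul_apply, smul_eq_mul, ← integral_const_mul]
        refine integral_congr_ae ((Lp.coeFn_smul c f).mono fun y hy => ?_)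
        simp only [hy, Pi.smul_apply, smul_eq_mul]
        ring }
  have hT : ∀ f : L2, (T₀ f : R3 → ℂ) =ᵐ[volume] fun x => ∫ y, (K x y : ℂ) * f y :=
    fun f => (hL f).coeFn_toLp
  -- The bound is the Hilbert–Schmidt norm of the kernel.
  refine ⟨T₀.mkContinuous (√(∫ x, A x)) fun f => ?_, fun f => (hi f).and (hT f)⟩
  have h0 : 0 ≤ ∫ x, A x := integral_nonneg fun x => integral_nonneg fun y => sq_nonneg _
  refine le_of_sq_le_sq ?_ (by positivity)
  rw [norm_L2_sq, mul_pow, Real.sq_sqrt h0, ← integral_mul_const]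
  refine integral_mono_ae (integrable_sq_norm_L2 _) (hA.mul_const _) ?_
  filter_upwards [hT f, hbd f] with x h1 h2
  rw [h1]
  exact h2

/-- Potentials decaying like `⟨x⟩^{-β}` with `β > 5`. -/
structure IsShortRange (V : R3 → ℝ) : Prop where
  measurable : Measurable V
  decay : ∃ C β : ℝ, 0 ≤ C ∧ 5 < β ∧ ∀ x, |V x| ≤ C * bracket x ^ (-β)

theorem vFun_nonneg (V : R3 → ℝ) (x : R3) : 0 ≤ vFun V x := Real.sqrt_nonneg _

theorem vFun_sq (V : R3 → ℝ) (x : R3) : vFun V x ^ 2 = |V x| := Real.sq_sqrt (abs_nonneg _)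

theorem uFun_mul_self (V : R3 → ℝ) (x : R3) : uFun V x * uFun V x = 1 := by
  unfold uFun; split_ifs <;> norm_num

theorem uFun_mul_vFun_sq (V : R3 → ℝ) (x : R3) : uFun V x * vFun V x ^ 2 = V x := by
  rw [vFun_sq]
  unfold uFun
  split_ifs with h
  · rw [abs_of_nonneg h, one_mul]
  · rw [abs_of_neg (not_le.mp h)]; ring

theorem abs_uFun (V : R3 → ℝ) (x : R3) : |uFun V x| = 1 := by
  unfold uFun; split_ifs <;> norm_num

theorem mulOp_coeFn {a : R3 → ℝ} (ha : MemLp (fun x => (a x : ℂ)) ∞) (f : L2) :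
    (mulOp a f : R3 → ℂ) =ᵐ[volume] fun x => (a x : ℂ) * f x := by
  rw [mulOp, dif_pos ha]
  filter_upwards [ContinuousLinearMap.coeFn_holder (r := 2) (ContinuousLinearMap.lsmul ℂ ℂ)
    (ha.toLp _) f, ha.coeFn_toLp] with x h1 h2
  change ((ContinuousLinearMap.lsmul ℂ ℂ).holder 2 (ha.toLp _) f) x = _
  rw [h1, h2]
  rfl

namespace IsShortRange

variable {V : R3 → ℝ}

theorem measurable_vFun (h : IsShortRange V) : Measurable (vFun V) := by
  have := h.measurable
  exact this.abs.sqrt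

theorem measurable_uFun (h : IsShortRange V) : Measurable (uFun V) :=
  Measurable.ite (measurableSet_le measurable_const h.measurable) measurable_const measurable_const

/-- The role of `β > 5`: the weight `⟨x⟩²` leaves decay exponent `β - 2`, which must exceed `3`.
This gives `vψ` a first moment and makes `vG₁v` and `vG₂v` Hilbert–Schmidt. -/
theorem integrable_bracket_mul_vFun_sq (h : IsShortRange V) :
    Integrable fun x => (bracket x * vFun V x) ^ 2 := by
  obtain ⟨C, β, hC, hβ, hle⟩ := h.decay
  have hm : Measurable fun x => (bracket x * vFun V x) ^ 2 :=
    (continuous_bracket.measurable.mul h.measurable_vFun).pow_const 2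
  refine ((integrable_bracket_rpow (s := β - 2) (by linarith)).const_mul C).mono'
    hm.aestronglyMeasurable (ae_of_all _ fun x => ?_)
  have hb := bracket_pos x
  rw [Real.norm_of_nonneg (by positivity), mul_pow, vFun_sq,
    show -(β - 2) = 2 + -β by ring, Real.rpow_add hb, Real.rpow_two]
  have := mul_le_mul_of_nonneg_left (hle x) (sq_nonneg (bracket x))
  linarith

theorem exists_bracket_mul_vFun_le (h : IsShortRange V) :
    ∃ K : ℝ, 0 ≤ K ∧ ∀ x, bracket x * vFun V x ≤ K := by
  obtain ⟨C, β, hC, hβ, hle⟩ := h.decay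
  refine ⟨√C, Real.sqrt_nonneg _, fun x => Real.le_sqrt_of_sq_le ?_⟩
  have hb := bracket_pos x
  rw [mul_pow, vFun_sq]
  calc _ ≤ bracket x ^ 2 * (C * bracket x ^ (-β)) := by gcongr; exact hle x
    _ = C * bracket x ^ (2 + -β) := by rw [Real.rpow_add hb, Real.rpow_two]; ring
    _ ≤ C * 1 := by
      gcongr
      exact Real.rpow_le_one_of_one_le_of_nonpos (one_le_bracket x) (by linarith)
    _ = C := mul_one C

theorem vFun_le_bracket_mul (x : R3) : vFun V x ≤ bracket x * vFun V x :=
  le_mul_of_one_le_left (vFun_nonneg V x) (one_le_bracket x)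

theorem memLp_bracket_mul_vFun (h : IsShortRange V) :
    MemLp (fun x => ((bracket x * vFun V x : ℝ) : ℂ)) 2 := by
  have hm := Complex.measurable_ofReal.comp (continuous_bracket.measurable.mul h.measurable_vFun)
  refine (memLp_two_iff_integrable_sq_norm hm.aestronglyMeasurable).mpr ?_
  exact h.integrable_bracket_mul_vFun_sq.congr (ae_of_all _ fun x => by simp [mul_pow])

theorem memLp_vFun (h : IsShortRange V) : MemLp (fun x => (vFun V x : ℂ)) 2 := by
  refine h.memLp_bracket_mul_vFun.mono
    (Complex.measurable_ofReal.comp h.measurable_vFun).aestronglyMeasurable (ae_of_all _ fun x => ?_)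
  rw [Complex.norm_real, Complex.norm_real, Real.norm_of_nonneg (vFun_nonneg V x),
    Real.norm_of_nonneg (mul_nonneg (bracket_pos x).le (vFun_nonneg V x))]
  exact vFun_le_bracket_mul x

theorem memLp_top_bracket_mul_vFun (h : IsShortRange V) :
    MemLp (fun x => ((bracket x * vFun V x : ℝ) : ℂ)) ∞ := by
  obtain ⟨K, hK, hle⟩ := h.exists_bracket_mul_vFun_le
  have hm := Complex.measurable_ofReal.comp (continuous_bracket.measurable.mul h.measurable_vFun)
  refine memLp_top_of_bound hm.aestronglyMeasurable K (ae_of_all _ fun x => ?_)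
  rw [Complex.norm_real, Real.norm_of_nonneg (mul_nonneg (bracket_pos x).le (vFun_nonneg V x))]
  exact hle x

theorem memLp_top_uFun_mul_vFun (h : IsShortRange V) :
    MemLp (fun x => ((uFun V x * vFun V x : ℝ) : ℂ)) ∞ := by
  refine h.memLp_top_bracket_mul_vFun.mono (Complex.measurable_ofReal.comp
    (h.measurable_uFun.mul h.measurable_vFun)).aestronglyMeasurable (ae_of_all _ fun x => ?_)
  rw [Complex.norm_real, Complex.norm_real, norm_mul, Real.norm_eq_abs (uFun V x), abs_uFun, one_mul,
    Real.norm_of_nonneg (vFun_nonneg V x),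
    Real.norm_of_nonneg (mul_nonneg (bracket_pos x).le (vFun_nonneg V x))]
  exact vFun_le_bracket_mul x

theorem memLp_top_uFun (h : IsShortRange V) : MemLp (fun x => (uFun V x : ℂ)) ∞ :=
  memLp_top_of_bound (Complex.measurable_ofReal.comp h.measurable_uFun).aestronglyMeasurable 1
    (ae_of_all _ fun x => by simp [abs_uFun])

theorem memLp_top (h : IsShortRange V) : MemLp (fun x => (V x : ℂ)) ∞ := by
  obtain ⟨C, β, hC, hβ, hle⟩ := h.decay
  refine memLp_top_of_bound (Complex.measurable_ofReal.comp h.measurable).aestronglyMeasurable C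
    (ae_of_all _ fun x => ?_)
  rw [Complex.norm_real, Real.norm_eq_abs]
  exact (hle x).trans (mul_le_of_le_one_right hC
    (Real.rpow_le_one_of_one_le_of_nonpos (one_le_bracket x) (by linarith)))

theorem measurable_kerG (j : ℕ) : Measurable (Function.uncurry (kerG j)) := by
  unfold Function.uncurry kerG
  fun_prop

theorem measurable_kerVGV (h : IsShortRange V) (j : ℕ) :
    Measurable (Function.uncurry (kerVGV V j)) :=
  ((h.measurable_vFun.comp measurable_fst).mul (measurable_kerG j)).mul
    (h.measurable_vFun.comp measurable_snd)

/-- The factor `|V(y)|` tames the `y`-integral of `|x-y|⁻²` uniformly in `x`; the factor `|V(x)|` is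
then integrable by itself. -/
theorem integrable_kerVGV_zero_sq (h : IsShortRange V) :
    Integrable fun p : R3 × R3 => kerVGV V 0 p.1 p.2 ^ 2 := by
  obtain ⟨C, β, hC, hβ, hle⟩ := h.decay
  obtain ⟨M, hM, hint⟩ := exists_integral_inv_norm_sq_mul_bracket_le (s := β) (by linarith)
  have hv : Integrable fun x => vFun V x ^ 2 := by
    have := h.memLp_vFun
    rw [memLp_two_iff_integrable_sq_norm this.1] at this
    simpa using this
  set D : R3 × R3 → ℝ := fun p => vFun V p.1 ^ 2 * ((‖p.1 - p.2‖ ^ 2)⁻¹ * bracket p.2 ^ (-β))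
  have hDm : Measurable D := by
    have h1 := (continuous_bracket_rpow (-β)).measurable
    have h2 : Measurable fun p : R3 × R3 => (‖p.1 - p.2‖ ^ 2)⁻¹ := by fun_prop
    exact ((h.measurable_vFun.comp measurable_fst).pow_const 2).mul
      (h2.mul (h1.comp measurable_snd))
  have hD0 : ∀ p, 0 ≤ D p := fun p => by
    have := bracket_rpow_pos p.2 (-β)
    positivity
  have hD : Integrable D := by
    rw [Measure.volume_eq_prod, integrable_prod_iff hDm.aestronglyMeasurable]
    refine ⟨ae_of_all _ fun x => (hint x).1.const_mul (vFun V x ^ 2), (hv.mul_const M).mono' ?_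
      (ae_of_all _ fun x => ?_)⟩
    · exact AEStronglyMeasurable.integral_prod_right' hDm.norm.aestronglyMeasurable
    · simp only [Real.norm_of_nonneg (hD0 _)]
      rw [Real.norm_of_nonneg (integral_nonneg fun y => hD0 _)]
      simp only [D]
      rw [integral_const_mul]
      exact mul_le_mul_of_nonneg_left (hint x).2 (sq_nonneg _)
  refine (hD.const_mul (((4 * Real.pi)⁻¹) ^ 2 * C)).mono'
    ((h.measurable_kerVGV 0).pow_const 2).aestronglyMeasurable (ae_of_all _ fun p => ?_)
  have := bracket_rpow_pos p.2 (-β)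
  rw [Real.norm_of_nonneg (sq_nonneg _), kerVGV, kerG_zero]
  calc _ = ((4 * Real.pi)⁻¹) ^ 2 * (vFun V p.1 ^ 2 * ((‖p.1 - p.2‖ ^ 2)⁻¹ * vFun V p.2 ^ 2)) := by
        ring
    _ ≤ ((4 * Real.pi)⁻¹) ^ 2 * (vFun V p.1 ^ 2 *
        ((‖p.1 - p.2‖ ^ 2)⁻¹ * (C * bracket p.2 ^ (-β)))) := by
      gcongr
      rw [vFun_sq]
      exact hle p.2
    _ = _ := by simp only [D]; ring

theorem integrable_kerVGV_sq_of_le (h : IsShortRange V) {j : ℕ} {c : ℝ}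
    (hc : ∀ x y, |kerG j x y| ≤ c * (bracket x * bracket y)) :
    Integrable fun p : R3 × R3 => kerVGV V j p.1 p.2 ^ 2 := by
  have hb := h.integrable_bracket_mul_vFun_sq
  refine ((hb.mul_prod hb).const_mul (c ^ 2)).mono'
    ((h.measurable_kerVGV j).pow_const 2).aestronglyMeasurable (ae_of_all _ fun p => ?_)
  rw [Real.norm_of_nonneg (sq_nonneg _), kerVGV]
  have h1 : kerG j p.1 p.2 ^ 2 ≤ (c * (bracket p.1 * bracket p.2)) ^ 2 := by
    rw [← sq_abs]
    exact pow_le_pow_left₀ (abs_nonneg _) (hc _ _) 2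
  calc _ = vFun V p.1 ^ 2 * vFun V p.2 ^ 2 * kerG j p.1 p.2 ^ 2 := by ring
    _ ≤ vFun V p.1 ^ 2 * vFun V p.2 ^ 2 * (c * (bracket p.1 * bracket p.2)) ^ 2 := by gcongr
    _ = _ := by ring

theorem integrable_kerVGV_sq (h : IsShortRange V) {j : ℕ} (hj : j ≤ 2) :
    Integrable fun p : R3 × R3 => kerVGV V j p.1 p.2 ^ 2 := by
  interval_cases j
  · exact h.integrable_kerVGV_zero_sq
  · refine h.integrable_kerVGV_sq_of_le (c := (4 * Real.pi)⁻¹) fun x y => ?_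
    rw [kerG_one, abs_of_nonneg (by positivity)]
    exact le_mul_of_one_le_right (by positivity)
      (one_le_mul_of_one_le_of_one_le (one_le_bracket x) (one_le_bracket y))
  · refine h.integrable_kerVGV_sq_of_le (c := (8 * Real.pi)⁻¹ * 2) fun x y => ?_
    rw [kerG_two, abs_of_nonneg (by positivity), mul_assoc]
    gcongr
    exact norm_sub_le_bracket_mul x y

theorem hasKernel_opVGV (h : IsShortRange V) {j : ℕ} (hj : j ≤ 2) :
    HasKernel (kerVGV V j) (opVGV V j) := by
  have := exists_hasKernel (h.measurable_kerVGV j) (h.integrable_kerVGV_sq hj)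
  rw [opVGV, integralOp, dif_pos this]
  exact this.choose_spec

end IsShortRange

theorem norm_kerG_zero_mul_bracket_sq (σ : ℝ) (x y : R3) :
    ‖((kerG 0 x y * bracket y ^ (-σ) : ℝ) : ℂ)‖ ^ 2 =
      ((4 * Real.pi)⁻¹) ^ 2 * ((‖x - y‖ ^ 2)⁻¹ * bracket y ^ (-(2 * σ))) := by
  have hb := bracket_pos y
  rw [Complex.norm_real, Real.norm_eq_abs, sq_abs, kerG_zero,
    show -(2 * σ) = -σ + -σ by ring, Real.rpow_add hb]
  ring

theorem measurable_kerG_zero_mul_bracket (σ : ℝ) (x : R3) :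
    Measurable fun y => ((kerG 0 x y * bracket y ^ (-σ) : ℝ) : ℂ) := by
  have h1 := (continuous_bracket_rpow (-σ)).measurable
  simp only [kerG_zero]
  fun_prop

/-- `G₀ f` converges absolutely, uniformly in the position, if `⟨x⟩^σ f ∈ L²` with `σ > 1/2`. -/
theorem exists_integral_kerG_zero_mul_le {σ : ℝ} (hσ : 1 / 2 < σ) {f : R3 → ℂ}
    (hf : MemLp (fun x => ((bracket x ^ σ : ℝ) : ℂ) * f x) 2) :
    ∃ M : ℝ, ∀ x, Integrable (fun y => (kerG 0 x y : ℂ) * f y) ∧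
      ∫ y, ‖(kerG 0 x y : ℂ) * f y‖ ≤ M := by
  -- Cauchy–Schwarz squares the weight `⟨y⟩^(-σ)`, so the condition `s > 1` becomes `σ > 1/2`.
  obtain ⟨M, hM, hint⟩ := exists_integral_inv_norm_sq_mul_bracket_le (s := 2 * σ) (by linarith)
  have hkm : ∀ x, MemLp (fun y => ((kerG 0 x y * bracket y ^ (-σ) : ℝ) : ℂ)) 2 := fun x => by
    rw [memLp_two_iff_integrable_sq_norm
      (measurable_kerG_zero_mul_bracket σ x).aestronglyMeasurable]
    simp only [norm_kerG_zero_mul_bracket_sq]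
    exact (hint x).1.const_mul _
  refine ⟨√(((4 * Real.pi)⁻¹) ^ 2 * M) *
    √(∫ y, ‖((bracket y ^ σ : ℝ) : ℂ) * f y‖ ^ 2), fun x => ?_⟩
  have hk : (fun y => (kerG 0 x y : ℂ) * f y) = fun y =>
      ((kerG 0 x y * bracket y ^ (-σ) : ℝ) : ℂ) * (((bracket y ^ σ : ℝ) : ℂ) * f y) := by
    ext y
    rw [← mul_assoc, ← Complex.ofReal_mul, mul_assoc (kerG 0 x y), ← Real.rpow_add (bracket_pos y),
      neg_add_cancel, Real.rpow_zero, mul_one]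
  refine ⟨by rw [hk]; exact (hkm x).integrable_mul hf, ?_⟩
  have hn : ∫ y, ‖(kerG 0 x y : ℂ) * f y‖ = ∫ y, ‖((kerG 0 x y * bracket y ^ (-σ) : ℝ) : ℂ)‖ *
      ‖((bracket y ^ σ : ℝ) : ℂ) * f y‖ := by
    refine integral_congr_ae (ae_of_all _ fun y => ?_)
    simp only [congrFun hk y, norm_mul]
  rw [hn]
  refine (integral_norm_mul_norm_le (hkm x) hf).trans ?_
  refine mul_le_mul_of_nonneg_right (Real.sqrt_le_sqrt ?_) (Real.sqrt_nonneg _)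
  simp only [norm_kerG_zero_mul_bracket_sq]
  rw [integral_const_mul]
  exact mul_le_mul_of_nonneg_left (hint x).2 (by positivity)

end ZeroEnergy

/-! ### Square integrable potentials, the space `S₂L²` and the operator `G₀vS₂`. -/

namespace ZeroEnergy

open FourierTransform

theorem inner_L2 (f g : L2) : inner ℂ f g = ∫ x, star (f x) * g x := by
  rw [L2.inner_def]
  congr 1
  ext x
  rw [RCLike.inner_apply, mul_comm]
  rfl

namespace IsNeutral

variable {ρ : R3 → ℂ}

theorem memLp_bracket_rpow_mul (h : IsNeutral ρ) :
    MemLp (fun x => ((bracket x ^ (1 : ℝ) : ℝ) : ℂ) * ρ x) 2 := by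
  simpa using h.memLp_bracket_mul

theorem integrable_kerG_zero_mul (h : IsNeutral ρ) (x : R3) :
    Integrable fun y => (kerG 0 x y : ℂ) * ρ y := by
  obtain ⟨M, hM⟩ := exists_integral_kerG_zero_mul_le (by norm_num) h.memLp_bracket_rpow_mul
  exact (hM x).1

/-- The potential `G₀ ρ` of a neutral density as an element of `L²`. -/
noncomputable def potential (h : IsNeutral ρ) : L2 := 𝓕⁻ (h.memLp_greenHat.toLp _)

theorem coeFn_potential (h : IsNeutral ρ) : (h.potential : R3 → ℂ) =ᵐ[volume] applyG0 ρ := by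
  refine (coeFn_fourierInv_toLp h.integrable_greenHat h.memLp_greenHat).trans
    (ae_of_all _ fun x => ?_)
  exact (applyG0_eq_fourierInv h x (h.integrable_kerG_zero_mul x)).symm

theorem fourier_potential (h : IsNeutral ρ) :
    (𝓕 h.potential : L2) =ᵐ[volume] greenHat ρ := by
  rw [potential, FourierTransform.fourier_fourierInv_eq]
  exact h.memLp_greenHat.coeFn_toLp

theorem inner_potential {ρ₁ ρ₂ : R3 → ℂ} (h₁ : IsNeutral ρ₁) (h₂ : IsNeutral ρ₂) :
    inner ℂ h₁.potential h₂.potential =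
      -∫ p : R3 × R3, (kerG 2 p.1 p.2 : ℂ) * (star (ρ₁ p.1) * ρ₂ p.2) := by
  rw [← integral_star_greenHat_mul h₁ h₂, ← Lp.inner_fourier_eq, inner_L2]
  refine integral_congr_ae ?_
  filter_upwards [h₁.fourier_potential, h₂.fourier_potential] with ξ e1 e2
  rw [e1, e2]

end IsNeutral

namespace IsShortRange

variable {V : R3 → ℝ}

theorem integrable_vFun_mul (h : IsShortRange V) (ψ : L2) :
    Integrable fun y => (vFun V y : ℂ) * ψ y :=
  h.memLp_vFun.integrable_mul (Lp.memLp ψ)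

theorem isNeutral_vFun_mul (h : IsShortRange V) {ψ : L2} (h0 : ∫ y, (vFun V y : ℂ) * ψ y = 0) :
    IsNeutral fun y => (vFun V y : ℂ) * ψ y := by
  have e : (fun y => (bracket y : ℂ) * ((vFun V y : ℂ) * ψ y)) =
      fun y => ((bracket y * vFun V y : ℝ) : ℂ) * ψ y := by
    ext y; push_cast; ring
  refine ⟨?_, ?_, h0⟩
  · rw [e]; exact h.memLp_bracket_mul_vFun.integrable_mul (Lp.memLp ψ)
  · rw [e]; exact (Lp.memLp ψ).mul' h.memLp_top_bracket_mul_vFun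

/-- The operator `v G_j v` applied to `ψ` is `v G_j (v ψ)`. -/
theorem opVGV_coeFn (h : IsShortRange V) {j : ℕ} (hj : j ≤ 2) (ψ : L2) :
    (opVGV V j ψ : R3 → ℂ) =ᵐ[volume] fun x =>
      (vFun V x : ℂ) * ∫ y, (kerG j x y : ℂ) * ((vFun V y : ℂ) * ψ y) := by
  filter_upwards [h.hasKernel_opVGV hj ψ] with x hx
  rw [hx.2, ← integral_const_mul]
  congr 1; ext y
  rw [kerVGV]; push_cast; ring

theorem opVGV_zero_coeFn (h : IsShortRange V) (ψ : L2) :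
    (opVGV V 0 ψ : R3 → ℂ) =ᵐ[volume] fun x =>
      (vFun V x : ℂ) * applyG0 (fun y => (vFun V y : ℂ) * ψ y) x :=
  h.opVGV_coeFn (by norm_num) ψ

theorem opVGV_one_coeFn (h : IsShortRange V) (ψ : L2) :
    (opVGV V 1 ψ : R3 → ℂ) =ᵐ[volume] fun x =>
      (vFun V x : ℂ) * (((4 * Real.pi)⁻¹ : ℝ) * ∫ y, (vFun V y : ℂ) * ψ y) := by
  refine (h.opVGV_coeFn (by norm_num) ψ).trans (ae_of_all _ fun x => ?_)
  simp only [kerG_one]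
  rw [integral_const_mul]

theorem opA0_eq_zero_iff (h : IsShortRange V) (ψ : L2) :
    opA0 V ψ = 0 ↔ ∀ᵐ x, (uFun V x : ℂ) * ψ x +
      (vFun V x : ℂ) * applyG0 (fun y => (vFun V y : ℂ) * ψ y) x = 0 := by
  rw [Lp.eq_zero_iff_ae_eq_zero]
  have e : (opA0 V ψ : R3 → ℂ) =ᵐ[volume] fun x => (uFun V x : ℂ) * ψ x +
      (vFun V x : ℂ) * applyG0 (fun y => (vFun V y : ℂ) * ψ y) x := by
    rw [opA0, add_apply]
    filter_upwards [Lp.coeFn_add (mulOp (uFun V) ψ) (opVGV V 0 ψ), h.opVGV_zero_coeFn ψ,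
      mulOp_coeFn h.memLp_top_uFun ψ] with x h1 h2 h3
    rw [h1, Pi.add_apply, h2, h3]
  exact ⟨fun H => (e.symm.trans H), fun H => e.trans H⟩

/-- As `G₁` has a constant kernel, `vG₁v` sees `ψ` only through its charge. -/
theorem inner_opVGV_one (h : IsShortRange V) (ψ : L2) :
    inner ℂ ψ (opVGV V 1 ψ) = ((4 * Real.pi)⁻¹ : ℝ) *
      (star (∫ y, (vFun V y : ℂ) * ψ y) * ∫ y, (vFun V y : ℂ) * ψ y) := by
  rw [inner_L2]
  set q := ∫ y, (vFun V y : ℂ) * ψ y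
  have e : ∫ x, star (ψ x) * (opVGV V 1 ψ) x =
      ∫ x, star ((vFun V x : ℂ) * ψ x) * (((4 * Real.pi)⁻¹ : ℝ) * q) := by
    refine integral_congr_ae ?_
    filter_upwards [h.opVGV_one_coeFn ψ] with x hx
    rw [hx, star_mul', ← starRingEnd_apply (vFun V x : ℂ), Complex.conj_ofReal]
    ring
  rw [e, integral_mul_const]
  have e2 : ∫ x, star ((vFun V x : ℂ) * ψ x) = star q := integral_conj
  rw [e2]
  ring

/-- The quadratic form of `m(0)` is `i/(4π)` times the squared modulus of the charge, so it vanishes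
only for neutral `ψ`. Conversely, zero charge annihilates `vG₁vψ` even before projecting. -/
theorem mem_ranS2_iff (h : IsShortRange V) (ψ : L2) :
    ψ ∈ ranS2 V ↔ opA0 V ψ = 0 ∧ ∫ y, (vFun V y : ℂ) * ψ y = 0 := by
  constructor
  · rintro ⟨χ, hχ, rfl⟩
    refine ⟨χ.2, ?_⟩
    have h1 : opM0 V χ = 0 := hχ
    have h2 : inner ℂ χ (opM0 V χ) = 0 := by rw [h1, inner_zero_right]
    have h3 : inner ℂ χ (opM0 V χ) = inner ℂ (χ : L2) (opA1 V χ) := by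
      simp only [opM0, ContinuousLinearMap.comp_apply, Submodule.subtypeL_apply]
      exact Submodule.inner_orthogonalProjectionOnto_eq_of_mem_left χ _
    rw [h3, opA1, smul_apply, inner_smul_right, h.inner_opVGV_one] at h2
    simpa [Complex.I_ne_zero, Real.pi_ne_zero] using h2
  · rintro ⟨h1, h2⟩
    refine ⟨⟨ψ, h1⟩, ?_, rfl⟩
    have h3 : opVGV V 1 ψ = 0 := by
      rw [Lp.eq_zero_iff_ae_eq_zero]
      filter_upwards [h.opVGV_one_coeFn ψ] with x hx
      rw [hx, h2]; simp
    change opM0 V ⟨ψ, h1⟩ = 0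
    simp [opM0, opA1, h3]


theorem isNeutral_of_ranS2 (h : IsShortRange V) (ψ : ranS2 V) :
    IsNeutral fun y => (vFun V y : ℂ) * (ψ : L2) y :=
  h.isNeutral_vFun_mul ((h.mem_ranS2_iff ψ).mp ψ.2).2

/-- `⟨G₀vχ, G₀vψ⟩ = -⟨χ, vG₂vψ⟩` on `S₂L²`. -/
theorem inner_potential_ranS2 (h : IsShortRange V) (χ ψ : ranS2 V) :
    inner ℂ (h.isNeutral_of_ranS2 χ).potential (h.isNeutral_of_ranS2 ψ).potential =
      -inner ℂ (χ : L2) (opVGV V 2 ψ) := by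
  have n1 := h.isNeutral_of_ranS2 χ
  have n2 := h.isNeutral_of_ranS2 ψ
  rw [IsNeutral.inner_potential, inner_L2, neg_inj, Measure.volume_eq_prod, integral_prod]
  · refine integral_congr_ae ?_
    filter_upwards [h.opVGV_coeFn le_rfl ψ] with x hx
    rw [hx, ← mul_assoc, ← integral_const_mul]
    congr 1; ext y
    rw [star_mul', ← starRingEnd_apply (vFun V x : ℂ), Complex.conj_ofReal]
    ring
  · rw [← Measure.volume_eq_prod]
    refine ((integrable_prod_norm_sub_mul n1 n2).const_mul (((8 * Real.pi)⁻¹ : ℝ) : ℂ)).congr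
      (ae_of_all _ fun p => ?_)
    simp only [kerG_two]
    push_cast; ring

/-- `G₀ v S₂` as a linear map. -/
noncomputable def potentialₗ (h : IsShortRange V) : ranS2 V →ₗ[ℂ] L2 where
  toFun ψ := (h.isNeutral_of_ranS2 ψ).potential
  map_add' χ ψ := by
    apply Lp.ext
    have n1 := h.isNeutral_of_ranS2 χ
    have n2 := h.isNeutral_of_ranS2 ψ
    refine (IsNeutral.coeFn_potential _).trans (Filter.EventuallyEq.trans ?_
      (Lp.coeFn_add _ _).symm)
    filter_upwards [n1.coeFn_potential, n2.coeFn_potential] with x e1 e2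
    rw [Pi.add_apply, e1, e2, applyG0, applyG0, applyG0,
      ← integral_add (n1.integrable_kerG_zero_mul x) (n2.integrable_kerG_zero_mul x)]
    refine integral_congr_ae ((Lp.coeFn_add (χ : L2) ψ).mono fun y hy => ?_)
    simp only [Submodule.coe_add, hy, Pi.add_apply]
    ring
  map_smul' c ψ := by
    apply Lp.ext
    have n1 := h.isNeutral_of_ranS2 ψ
    refine (IsNeutral.coeFn_potential _).trans (Filter.EventuallyEq.trans ?_
      (Lp.coeFn_smul _ _).symm)
    filter_upwards [n1.coeFn_potential] with x e1
    rw [RingHom.id_apply, Pi.smul_apply, e1, applyG0, applyG0, smul_eq_mul, ← integral_const_mul]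
    refine integral_congr_ae ((Lp.coeFn_smul c (ψ : L2)).mono fun y hy => ?_)
    simp only [Submodule.coe_smul, hy, Pi.smul_apply, smul_eq_mul]
    ring

/-- `G₀ v S₂` as a bounded operator. -/
noncomputable def potentialL (h : IsShortRange V) : ranS2 V →L[ℂ] L2 :=
  h.potentialₗ.mkContinuous (√‖opVGV V 2‖) fun ψ => by
    refine le_of_sq_le_sq ?_ (by positivity)
    -- The energy identity with `χ = ψ` bounds `G₀vS₂` by the bounded operator `vG₂v`.
    have e : (‖h.potentialₗ ψ‖ ^ 2 : ℝ) = ‖inner ℂ (ψ : L2) (opVGV V 2 ψ)‖ := by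
      rw [← norm_neg (inner ℂ _ _), ← h.inner_potential_ranS2 ψ ψ, inner_self_eq_norm_sq_to_K]
      simp [potentialₗ]
    rw [e, mul_pow, Real.sq_sqrt (norm_nonneg _)]
    refine (norm_inner_le_norm _ _).trans ?_
    calc _ ≤ ‖(ψ : L2)‖ * (‖opVGV V 2‖ * ‖(ψ : L2)‖) := by
          gcongr; exact (opVGV V 2).le_opNorm _
      _ = _ := by rw [Submodule.coe_norm]; ring

theorem potentialL_apply (h : IsShortRange V) (ψ : ranS2 V) :
    h.potentialL ψ = (h.isNeutral_of_ranS2 ψ).potential := rfl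

theorem isG0VS2_potentialL (h : IsShortRange V) : IsG0VS2 V h.potentialL := fun ψ =>
  ⟨ae_of_all _ (h.isNeutral_of_ranS2 ψ).integrable_kerG_zero_mul,
    (h.isNeutral_of_ranS2 ψ).coeFn_potential⟩

/-- The weak form of `S₂vG₂vS₂ = -T*T`, as the abstract Hilbert space lemmas require it. -/
theorem inner_opS2VG2VS2 (h : IsShortRange V) (χ ψ : ranS2 V) :
    inner ℂ χ (opS2VG2VS2 V ψ) = -inner ℂ (h.potentialL χ) (h.potentialL ψ) := by
  rw [potentialL_apply, potentialL_apply, h.inner_potential_ranS2, neg_neg]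
  exact Submodule.inner_orthogonalProjectionOnto_eq_of_mem_left χ _

/-- `A₀ψ = 0` says `Uψ = -v G₀vψ`; here `|U| = 1` and `v` is bounded. -/
theorem exists_norm_le_mul_norm_potentialL (h : IsShortRange V) :
    ∃ K : ℝ, 0 ≤ K ∧ ∀ ψ : ranS2 V, ‖ψ‖ ≤ K * ‖h.potentialL ψ‖ := by
  obtain ⟨K, hK, hle⟩ := h.exists_bracket_mul_vFun_le
  refine ⟨K, hK, fun ψ => Lp.norm_le_mul_norm_of_ae_le_mul ?_⟩
  have h1 := (h.opA0_eq_zero_iff ψ).mp ((h.mem_ranS2_iff ψ).mp ψ.2).1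
  filter_upwards [h1, (h.isNeutral_of_ranS2 ψ).coeFn_potential] with x e1 e2
  rw [potentialL_apply, e2]
  have e3 := congrArg norm (eq_neg_of_add_eq_zero_left e1)
  rw [norm_mul, norm_neg, norm_mul, Complex.norm_real, Complex.norm_real, Real.norm_eq_abs, abs_uFun,
    one_mul, Real.norm_of_nonneg (vFun_nonneg V x)] at e3
  refine e3.le.trans ?_
  gcongr
  exact (vFun_le_bracket_mul x).trans (hle x)

end IsShortRange

end ZeroEnergy

/-! ### Abstract projections `T(T*T)⁻¹T*`. -/

namespace ZeroEnergy

open FourierTransform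

section Hilbert

variable {E F : Type*} [NormedAddCommGroup E] [InnerProductSpace ℂ E] [CompleteSpace E]
  [NormedAddCommGroup F] [InnerProductSpace ℂ F]

/-- A map bounded below makes the form of `T*T` coercive, and coercivity gives invertibility. -/
theorem exists_equiv_of_inner_eq {T : E →L[ℂ] F} {B : E →L[ℂ] E} {K : ℝ} (hK : 0 ≤ K)
    (hB : ∀ x y, inner ℂ x (B y) = -inner ℂ (T x) (T y)) (hT : ∀ x, ‖x‖ ≤ K * ‖T x‖) :
    ∃ e : E ≃L[ℂ] E, (e : E →L[ℂ] E) = B := by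
  have hu : IsUnit B := by
    -- `K + 1` replaces `K` so that the coercivity constant makes sense when `K = 0`.
    refine ContinuousLinearMap.isUnit_of_forall_le_norm_inner_map B
      (c := NNReal.mk ((K + 1) ^ 2)⁻¹ (by positivity))
      (NNReal.coe_pos.mp (by rw [NNReal.coe_mk]; positivity)) fun x => ?_
    have h1 : ‖inner ℂ (B x) x‖ = ‖T x‖ ^ 2 := by
      rw [norm_inner_symm, hB, norm_neg, inner_self_eq_norm_sq_to_K]
      simp
    rw [h1, NNReal.coe_mk, ← div_eq_mul_inv, div_le_iff₀ (by positivity), ← mul_pow]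
    refine pow_le_pow_left₀ (norm_nonneg _) ((hT x).trans ?_) 2
    nlinarith [norm_nonneg (T x)]
  obtain ⟨u, hu⟩ := hu
  exact ⟨ContinuousLinearEquiv.ofUnit u, hu⟩

variable [CompleteSpace F] {T : E →L[ℂ] F} {B : E ≃L[ℂ] E}

theorem adjoint_apply_eq_neg (hB : ∀ x y, inner ℂ x (B y) = -inner ℂ (T x) (T y)) (x : E) :
    T.adjoint (T x) = -B x := by
  refine ext_inner_left ℂ fun y => ?_
  rw [ContinuousLinearMap.adjoint_inner_right, inner_neg_right, hB, neg_neg]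

theorem projection_apply_range (hB : ∀ x y, inner ℂ x (B y) = -inner ℂ (T x) (T y)) (x : E) :
    (-(T ∘L (B.symm : E →L[ℂ] E) ∘L T.adjoint)) (T x) = T x := by
  simp [adjoint_apply_eq_neg hB]

theorem isStarProjection_of_inner_eq (hB : ∀ x y, inner ℂ x (B y) = -inner ℂ (T x) (T y)) :
    IsStarProjection (-(T ∘L (B.symm : E →L[ℂ] E) ∘L T.adjoint)) := by
  refine ⟨?_, ?_⟩
  · ext x
    have h := projection_apply_range hB (-B.symm (T.adjoint x))
    rw [mul_apply_eq_comp]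
    simpa using h
  · rw [ContinuousLinearMap.isSelfAdjoint_iff_isSymmetric]
    intro x y
    -- Applying `hB` to this pair in both orders, with one conjugation, gives the symmetry.
    have h1 := hB (B.symm (T.adjoint x)) (B.symm (T.adjoint y))
    have h2 := hB (B.symm (T.adjoint y)) (B.symm (T.adjoint x))
    rw [B.apply_symm_apply, ContinuousLinearMap.adjoint_inner_right] at h1 h2
    have h3 := congrArg (starRingEnd ℂ) h2
    rw [map_neg, inner_conj_symm, inner_conj_symm] at h3
    simp [h1, h3]

theorem range_projection_of_inner_eq (hB : ∀ x y, inner ℂ x (B y) = -inner ℂ (T x) (T y)) :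
    LinearMap.range (-(T ∘L (B.symm : E →L[ℂ] E) ∘L T.adjoint)).toLinearMap =
      LinearMap.range T.toLinearMap := by
  apply le_antisymm
  · rintro _ ⟨x, rfl⟩
    exact ⟨-B.symm (T.adjoint x), by simp⟩
  · rintro _ ⟨x, rfl⟩
    exact ⟨T x, projection_apply_range hB x⟩

end Hilbert

/-! ### The adjoint `S₂vG₀` and the zero-energy eigenspace. -/

theorem measurable_kerG_zero : Measurable fun p : R3 × R3 => (kerG 0 p.1 p.2 : ℂ) :=
  Complex.measurable_ofReal.comp (IsShortRange.measurable_kerG 0)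

theorem aestronglyMeasurable_applyG0 {f : R3 → ℂ} (hf : AEStronglyMeasurable f) :
    AEStronglyMeasurable (applyG0 f) :=
  AEStronglyMeasurable.integral_prod_right' (μ := volume) (ν := volume)
    (f := fun p : R3 × R3 => (kerG 0 p.1 p.2 : ℂ) * f p.2)
    (measurable_kerG_zero.aestronglyMeasurable.mul hf.comp_snd)

theorem kerG_symm (j : ℕ) (x y : R3) : kerG j x y = kerG j y x := by
  rw [kerG, kerG, norm_sub_rev]

theorem norm_applyG0_le {f : R3 → ℂ} {M : ℝ} {x : R3}
    (hM : ∫ y, ‖(kerG 0 x y : ℂ) * f y‖ ≤ M) : ‖applyG0 f x‖ ≤ M :=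
  (norm_integral_le_integral_norm _).trans hM

/-- Symmetry of `G₀` between an integrable density and a weighted `L²` function. -/
theorem integral_star_applyG0_mul {ρ f : R3 → ℂ} (hρ : Integrable ρ) (hf : AEStronglyMeasurable f)
    {M : ℝ} (hM : ∀ x, Integrable (fun y => (kerG 0 x y : ℂ) * f y) ∧
      ∫ y, ‖(kerG 0 x y : ℂ) * f y‖ ≤ M) :
    ∫ y, star (applyG0 ρ y) * f y = ∫ x, star (ρ x) * applyG0 f x := by
  have hs := integrable_star hρ
  have hm : AEStronglyMeasurable
      (fun p : R3 × R3 => star (ρ p.1) * ((kerG 0 p.1 p.2 : ℂ) * f p.2))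
      ((volume : Measure R3).prod volume) :=
    hs.1.comp_fst.mul (measurable_kerG_zero.aestronglyMeasurable.mul hf.comp_snd)
  have hI : Integrable (fun p : R3 × R3 => star (ρ p.1) * ((kerG 0 p.1 p.2 : ℂ) * f p.2))
      ((volume : Measure R3).prod volume) := by
    rw [integrable_prod_iff hm]
    refine ⟨ae_of_all _ fun x => (hM x).1.const_mul (star (ρ x)), (hρ.norm.mul_const M).mono'
      hm.norm.integral_prod_right' (ae_of_all _ fun x => ?_)⟩
    rw [Real.norm_of_nonneg (integral_nonneg fun y => norm_nonneg _)]
    simp only [norm_mul (star (ρ x)), norm_star]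
    rw [integral_const_mul]
    exact mul_le_mul_of_nonneg_left (hM x).2 (norm_nonneg _)
  have hswap := integral_integral_swap
    (f := fun x y => star (ρ x) * ((kerG 0 x y : ℂ) * f y)) hI
  calc _ = ∫ y, ∫ x, star (ρ x) * ((kerG 0 x y : ℂ) * f y) := by
        congr 1; ext y
        have e : star (applyG0 ρ y) = ∫ x, star (ρ x) * (kerG 0 x y : ℂ) := by
          rw [applyG0, ← starRingEnd_apply, ← integral_conj]
          congr 1; ext x
          rw [map_mul, Complex.conj_ofReal, kerG_symm, mul_comm]
          rfl
        rw [e, ← integral_mul_const]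
        simp only [mul_assoc]
    _ = _ := by
      rw [← hswap]
      congr 1; ext x
      rw [integral_const_mul, applyG0]

namespace IsShortRange

variable {V : R3 → ℝ}

/-- The weight makes `G₀f` bounded, so `vG₀f` is in `L²`; the symmetric real kernel of `G₀` then
moves across the inner product by Fubini. -/
theorem isS2VG0_adjoint (h : IsShortRange V) : IsS2VG0 V h.potentialL.adjoint := by
  intro σ f hσ hf
  obtain ⟨M, hM⟩ := exists_integral_kerG_zero_mul_le hσ hf
  have hL : MemLp (fun x => (vFun V x : ℂ) * applyG0 f x) 2 := by
    have hG : MemLp (applyG0 f) ∞ := memLp_top_of_bound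
      (aestronglyMeasurable_applyG0 (Lp.memLp f).1) M
      (ae_of_all _ fun x => norm_applyG0_le (hM x).2)
    exact hG.mul' h.memLp_vFun
  refine ⟨ae_of_all _ fun x => (hM x).1, hL.toLp _, hL.coeFn_toLp, ?_⟩
  refine ext_inner_left ℂ fun ψ => ?_
  rw [ContinuousLinearMap.adjoint_inner_right, projS2,
    Submodule.inner_orthogonalProjectionOnto_eq_of_mem_left, inner_L2, inner_L2]
  have n := h.isNeutral_of_ranS2 ψ
  calc _ = ∫ y, star (applyG0 (fun y => (vFun V y : ℂ) * (ψ : L2) y) y) * f y :=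
        integral_congr_ae (n.coeFn_potential.mono fun y hy => by
          simp only [potentialL_apply, hy])
    _ = _ := integral_star_applyG0_mul n.integrable (Lp.memLp f).1 hM
    _ = _ := integral_congr_ae (hL.coeFn_toLp.mono fun x hx => by
        simp only [hx, star_mul', ← starRingEnd_apply (vFun V x : ℂ), Complex.conj_ofReal]
        ring)

/-- The zero energy equation as an equation between distributions. -/
theorem mem_eigenspaceAt_zero_iff (g : L2) :
    g ∈ eigenspaceAt (hamiltonian V) 0 ↔ toDist (mulOp V g) = Δ (toDist g) := by
  have key : ∀ g' : sobolevH2, ((hamiltonian V).toFun -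
      (0 : ℂ) • (hamiltonian V).domain.subtype) g' = -laplacianH2 g' + mulOp V g' := fun g' => by
    rw [zero_smul, sub_zero]
    rfl
  constructor
  · rintro ⟨g', hg', rfl⟩
    have h1 : -laplacianH2 g' + mulOp V g' = 0 := (key g').symm.trans hg'
    have h2 : mulOp V g' = laplacianH2 g' := by
      rw [neg_add_eq_zero] at h1; exact h1.symm
    exact (congrArg toDist h2).trans (laplacianH2_spec g')
  · intro H
    refine ⟨⟨g, mem_sobolevH2_of_laplacian H⟩, ?_, rfl⟩
    refine (key ⟨g, mem_sobolevH2_of_laplacian H⟩).trans ?_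
    rw [neg_add_eq_zero]
    exact toDist_injective ((laplacianH2_spec _).trans H.symm)

/-- For `g = G₀vψ` one has `-Δg = vψ`, while `vg = -Uψ` and `V = Uv²` give `Vg = -vψ`. -/
theorem potentialL_mem_eigenspaceAt (h : IsShortRange V) (ψ : ranS2 V) :
    h.potentialL ψ ∈ eigenspaceAt (hamiltonian V) 0 := by
  have n := h.isNeutral_of_ranS2 ψ
  have h1 := (h.opA0_eq_zero_iff ψ).mp ((h.mem_ranS2_iff ψ).mp ψ.2).1
  rw [mem_eigenspaceAt_zero_iff, toDist_eq_laplacian_iff, potentialL_apply]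
  have e : mulOp V n.potential = -n.memLp.toLp _ := by
    apply Lp.ext
    filter_upwards [mulOp_coeFn h.memLp_top n.potential, n.coeFn_potential, h1,
      Lp.coeFn_neg (n.memLp.toLp _), n.memLp.coeFn_toLp] with x e1 e2 e3 e4 e5
    rw [e1, e2, e4, Pi.neg_apply, e5]
    have u := uFun_mul_self V x
    have w := uFun_mul_vFun_sq V x
    have u' : (uFun V x : ℂ) * uFun V x = 1 := by exact_mod_cast u
    have w' : (uFun V x : ℂ) * (vFun V x : ℂ) ^ 2 = V x := by exact_mod_cast w
    rw [← w']
    linear_combination (uFun V x : ℂ) * vFun V x * e3 - (vFun V x : ℂ) * (ψ : L2) x * u'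
  rw [e, FourierTransform.fourier_neg]
  filter_upwards [Lp.coeFn_neg (𝓕 (n.memLp.toLp _) : L2), coeFn_fourier_toLp n.integrable n.memLp,
    n.fourier_potential, ae_norm_pos] with ξ e1 e2 e3 e4
  rw [e1, Pi.neg_apply, e2, e3, greenHat]
  have h4 : (‖ξ‖ : ℂ) ≠ 0 := by exact_mod_cast e4.ne'
  have := Real.pi_ne_zero
  push_cast
  field_simp
  ring

/-- A square integrable quotient `𝓕ρ/|ξ|²` in three dimensions forces total charge zero. -/
theorem integral_eq_zero_of_greenHat {ρ : R3 → ℂ} (hρ : Integrable ρ) (hg : MemLp (greenHat ρ) 2) :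
    ∫ x, ρ x = 0 := by
  have h0 : 𝓕 ρ 0 = ∫ x, ρ x := by simp [Real.fourier_eq']
  rw [← h0]
  by_contra hne
  set c := ‖𝓕 ρ 0‖ / 2
  have hc : 0 < c := half_pos (norm_pos_iff.mpr hne)
  have hlt : c < ‖𝓕 ρ 0‖ := half_lt_self (norm_pos_iff.mpr hne)
  have hcont := (continuous_fourier hρ).norm.continuousAt (x := 0)
  obtain ⟨r, hr, hball⟩ := Metric.eventually_nhds_iff_ball.mp
    (hcont.eventually (lt_mem_nhds hlt))
  apply not_integrableOn_ball_norm_zpow_neg_four hr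
  -- On the ball `|𝓕ρ| > c`, so this multiple of `|greenHat ρ|²` dominates `|ξ|⁻⁴`.
  have hi := ((memLp_two_iff_integrable_sq_norm hg.1).mp hg).const_mul
    ((4 * Real.pi ^ 2) ^ 2 / c ^ 2)
  refine hi.integrableOn.mono' (Measurable.aestronglyMeasurable (by fun_prop))
    ((ae_restrict_mem measurableSet_ball).mono fun ξ hξ => ?_)
  rw [Real.norm_of_nonneg (by positivity), IsNeutral.norm_greenHat]
  have h1 := (hball ξ hξ).le
  have hpi := Real.pi_ne_zero
  calc (‖ξ‖ ^ 4)⁻¹ = (4 * Real.pi ^ 2) ^ 2 / c ^ 2 * ((4 * Real.pi ^ 2 * ‖ξ‖ ^ 2)⁻¹ * c) ^ 2 := by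
        rcases eq_or_ne ξ 0 with rfl | hξ0
        · simp
        · have := norm_ne_zero_iff.mpr hξ0
          field_simp
    _ ≤ _ := by gcongr

theorem eigenspaceAt_le_range (h : IsShortRange V) :
    eigenspaceAt (hamiltonian V) 0 ≤ LinearMap.range h.potentialL.toLinearMap := by
  intro g hg
  rw [mem_eigenspaceAt_zero_iff, toDist_eq_laplacian_iff] at hg
  -- This choice is forced by `Uψ + vg = 0`, and it makes `vψ = -Vg`.
  set ψ : L2 := -mulOp (fun x => uFun V x * vFun V x) g with hψ_def
  have hψ : (ψ : R3 → ℂ) =ᵐ[volume] fun x => -((uFun V x * vFun V x : ℝ) : ℂ) * g x := by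
    filter_upwards [Lp.coeFn_neg (mulOp (fun x => uFun V x * vFun V x) g),
      mulOp_coeFn h.memLp_top_uFun_mul_vFun g] with x e1 e2
    rw [hψ_def, e1, Pi.neg_apply, e2]; ring
  set ρ : R3 → ℂ := fun y => (vFun V y : ℂ) * ψ y with hρ_def
  have hρi : Integrable ρ := h.integrable_vFun_mul ψ
  have hρV : -ρ =ᵐ[volume] mulOp V g := by
    filter_upwards [hψ, mulOp_coeFn h.memLp_top g] with x e1 e2
    rw [e2, Pi.neg_apply, hρ_def]
    simp only
    rw [e1, ← uFun_mul_vFun_sq V x]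
    push_cast; ring
  have hρ2 : MemLp (-ρ) 2 := (memLp_congr_ae hρV).mpr (Lp.memLp _)
  -- The eigenvalue equation in Fourier variables, divided by `4π²|ξ|²`; neutrality of `ρ` is not
  -- yet known and is deduced from this.
  have hgreen : greenHat ρ =ᵐ[volume] (𝓕 g : L2) := by
    have e : mulOp V g = hρ2.toLp _ := Lp.ext (hρV.symm.trans hρ2.coeFn_toLp.symm)
    rw [e] at hg
    filter_upwards [hg, coeFn_fourier_toLp hρi.neg hρ2, ae_norm_pos] with ξ e1 e2 e3
    have e4 : 𝓕 (-ρ) ξ = -𝓕 ρ ξ := by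
      rw [Real.fourier_eq, Real.fourier_eq, ← integral_neg]
      simp
    have h4 : (‖ξ‖ : ℂ) ≠ 0 := by exact_mod_cast e3.ne'
    have hpi := Real.pi_ne_zero
    rw [e2, e4, neg_mul, neg_inj] at e1
    rw [greenHat, e1]
    push_cast
    field_simp
    ring
  have h0 : ∫ y, (vFun V y : ℂ) * ψ y = 0 :=
    integral_eq_zero_of_greenHat hρi ((memLp_congr_ae hgreen).mpr (Lp.memLp _))
  have n : IsNeutral ρ := h.isNeutral_vFun_mul h0
  have hpot : n.potential = g := by
    rw [IsNeutral.potential, show n.memLp_greenHat.toLp _ = 𝓕 g from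
      Lp.ext (n.memLp_greenHat.coeFn_toLp.trans hgreen), FourierTransform.fourierInv_fourier_eq]
  have hA : opA0 V ψ = 0 := by
    rw [h.opA0_eq_zero_iff]
    have hp := n.coeFn_potential
    rw [hpot] at hp
    filter_upwards [hψ, hp] with x e1 e2
    rw [← e2, e1]
    have u' : (uFun V x : ℂ) * uFun V x = 1 := by exact_mod_cast uFun_mul_self V x
    push_cast
    linear_combination -(vFun V x : ℂ) * g x * u'
  exact ⟨⟨ψ, (h.mem_ranS2_iff ψ).mpr ⟨hA, h0⟩⟩, hpot⟩

theorem range_potentialL (h : IsShortRange V) :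
    LinearMap.range h.potentialL.toLinearMap = eigenspaceAt (hamiltonian V) 0 := by
  refine le_antisymm ?_ h.eigenspaceAt_le_range
  rintro _ ⟨ψ, rfl⟩
  exact h.potentialL_mem_eigenspaceAt ψ

end IsShortRange

end ZeroEnergy

theorem mainTheorem3 (V : ZeroEnergy.R3 → ℝ) (hV : Measurable V) (C β : ℝ) (hβ : 5 < β)
    (hdecay : ∀ x, |V x| ≤ C * ZeroEnergy.bracket x ^ (-β)) :
    (∀ j : ℕ, j ≤ 2 → ZeroEnergy.HasKernel (ZeroEnergy.kerVGV V j) (ZeroEnergy.opVGV V j)) ∧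
    ∃ (B : ZeroEnergy.ranS2 V ≃L[ℂ] ZeroEnergy.ranS2 V)
      (T : ZeroEnergy.ranS2 V →L[ℂ] ZeroEnergy.L2)
      (R : ZeroEnergy.L2 →L[ℂ] ZeroEnergy.ranS2 V),
      (B : ZeroEnergy.ranS2 V →L[ℂ] ZeroEnergy.ranS2 V) = ZeroEnergy.opS2VG2VS2 V ∧
      ZeroEnergy.IsG0VS2 V T ∧
      ZeroEnergy.IsS2VG0 V R ∧
      IsStarProjection
        (-(T ∘L (B.symm : ZeroEnergy.ranS2 V →L[ℂ] ZeroEnergy.ranS2 V) ∘L R)) ∧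
      LinearMap.range
        (-(T ∘L (B.symm : ZeroEnergy.ranS2 V →L[ℂ] ZeroEnergy.ranS2 V) ∘L R) :
          ZeroEnergy.L2 →L[ℂ] ZeroEnergy.L2).toLinearMap =
        ZeroEnergy.eigenspaceAt (ZeroEnergy.hamiltonian V) 0 := by
  have hC : 0 ≤ C := by
    have h := (abs_nonneg _).trans (hdecay 0)
    exact nonneg_of_mul_nonneg_left h (ZeroEnergy.bracket_rpow_pos 0 _)
  have h : ZeroEnergy.IsShortRange V := ⟨hV, C, β, hC, hβ, hdecay⟩
  obtain ⟨K, hK, hle⟩ := h.exists_norm_le_mul_norm_potentialL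
  obtain ⟨B, hB⟩ := ZeroEnergy.exists_equiv_of_inner_eq hK h.inner_opS2VG2VS2 hle
  have hinner : ∀ x y : ZeroEnergy.ranS2 V,
      inner ℂ x (B y) = -inner ℂ (h.potentialL x) (h.potentialL y) := fun x y => by
    rw [← h.inner_opS2VG2VS2, ← hB]
    rfl
  -- Taking `R = T*` gives the required operator the form `T(T*T)⁻¹T*`.
  exact ⟨fun j hj => h.hasKernel_opVGV hj, B, h.potentialL, h.potentialL.adjoint, hB,
    h.isG0VS2_potentialL, h.isS2VG0_adjoint, ZeroEnergy.isStarProjection_of_inner_eq hinner,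
    (ZeroEnergy.range_projection_of_inner_eq hinner).trans h.range_potentialL⟩
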